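/- Let $0<q<1$ and let $w$ be a nonnegative, measurable, integrable function on $(0,\infty)$ with $w(xq)=x\,w(x)$ for all $x>0$. Let $d\mu=w(x)\,dx$ on $(0,\infty)$, and let $L$ be the operator in $L^2(\mu)$ (complex valued functions) whose domain is the space of $f\in L^2(\mu)$ vanishing $\mu$-a.e. outside a compact subset of $(0,\infty)$, given by $$(Lf)(x)=f(xq)-\frac1x f(x)+\frac1x f(x/q).$$ Let $(e_k)_{k\in\mathbb Z}$ be the standard basis of $\ell^2(\mathbb Z)$. For $t>0$ let $J_t$ be the operator in $\ell^2(\mathbb Z)$ with domain the finite linear combinations of the $e_k$ and $$J_te_k=a_k(t)e_{k+1}+b_k(t)e_k+a_{k-1}(t)e_{k-1},\qquad a_k(t)=\frac1{\sqrt{tq^{k+1}}},\quad b_k(t)=-\frac1{tq^k}.$$ Put $\Omega=\{t\in(q,1]: w(t)>0\}$. The direct integral $\int_\Omega^\oplus \ell^2(\mathbb Z)\,dt$ is the Hilbert space of (classes of) measurable square integrable functions $u:\Omega\to\ell^2(\mathbb Z)$. For a field $(A_t)_{t\in\Omega}$ of operators in $\ell^2(\mathbb Z)$, the operator $\int_\Omega^\oplus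 A_t\,dt$ has as domain all $u$ with $u(t)\in\mathrm{dom}(A_t)$ for a.e. $t$ and $t\mapsto A_tu(t)$ in $\int_\Omega^\oplus \ell^2(\mathbb Z)\,dt$, and it maps $u$ to $t\mapsto A_tu(t)$. Then $L$ is densely defined, and for every $t\in\Omega$ the operator $J_t$ is densely defined and its adjoint $J_t^*$ is self-adjoint. There is a unitary operator $I:L^2(\mu)\to\int_\Omega^\oplus\ell^2(\mathbb Z)\,dt$ with $$(If)(t)=\sum_{k\in\mathbb Z} f(tq^k)\,q^{k/2}\sqrt{w(tq^k)}\;e_k\qquad\text{for a.e. } t\in\Omega$$ for all compactly supported $f\in L^2(\mu)$ (by density there is only one), and the following hold. (a) $I$ intertwines $L^*$ with $\int_\Omega^\oplus J_t^*\,dt$, domains included: $L^*=I^*\bigl(\int_\Omega^\oplus J_t^*\,dt\bigr)I$. (b) $L^*$ is a self-adjoint extension of $L$, and it is the only one. (c) For every bounded Borel function $f:\mathbb R\to\mathbb C$, $$f(L^*)=I^*\Bigl(\int_\Omega^\oplus f(J_t^*)\,dt\Bigr)I .$$ Here, for a self-adjoint operator $T$, the map $f\mapsto f(T)$ is the bounded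 Borel functional calculus of $T$, that is, the unique unital $*$-homomorphism from the bounded Borel functions on $\mathbb R$ to the bounded operators that is strongly continuous under uniformly bounded pointwise convergence of sequences and maps $x\mapsto (x-z)^{-1}$ to $(T-z)^{-1}$ for all nonreal $z$; part of the claim is that it exists and is unique for $T=L^*$ and for $T=J_t^*$, $t\in\Omega$. -/

import Mathlib

open MeasureTheory Set Filter Topology

noncomputable section

namespace StieltjesWigert

/-! ## The weight and the Hilbert space `L²(μ)` -/

/-- The standing assumptions: `0 < q < 1`, and `w` is a nonnegative integrable density on `(0,∞)`
with `w(xq) = x w(x)`. Only the values of `w` on `(0,∞)` play a role. -/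
structure IsWeight (q : ℝ) (w : ℝ → ℝ) : Prop where
  q_pos : 0 < q
  q_lt_one : q < 1
  measurable : Measurable w
  nonneg : ∀ x, 0 < x → 0 ≤ w x
  integrableOn : IntegrableOn w (Ioi 0)
  func_eq : ∀ x, 0 < x → w (x * q) = x * w x

/-- The measure `w(x) dx` on `(0,∞)`, viewed as a measure on `ℝ`. -/
def weightMeasure (w : ℝ → ℝ) : Measure ℝ :=
  (volume.restrict (Ioi 0)).withDensity fun x => ENNReal.ofReal (w x)

/-- The Hilbert space `L²(μ)`, where `μ = w(x) dx` on `(0,∞)`. -/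
abbrev L2 (w : ℝ → ℝ) : Type := Lp ℂ 2 (weightMeasure w)

/-- `f` vanishes (`μ`-almost everywhere) outside some compact subset of `(0,∞)`. -/
def HasCptSupport (w : ℝ → ℝ) (f : ℝ → ℂ) : Prop :=
  ∃ K : Set ℝ, IsCompact K ∧ K ⊆ Ioi 0 ∧ ∀ᵐ x ∂(weightMeasure w), x ∉ K → f x = 0

/-- The `q`-difference expression `f(xq) - f(x)/x + f(x/q)/x`. -/
def diffExpr (q : ℝ) (f : ℝ → ℂ) (x : ℝ) : ℂ :=
  f (x * q) - 1 / (x : ℂ) * f x + 1 / (x : ℂ) * f (x / q)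

/-! ### The difference expression is well defined on compactly supported classes -/

theorem map_mul_weightMeasure {w : ℝ → ℝ} (hw : Measurable w) {s : ℝ} (hs : 0 < s) {r : ℝ → ℝ}
    (hr : Measurable r) (hr0 : ∀ x, 0 < x → 0 ≤ r x)
    (h : ∀ x, 0 < x → s⁻¹ * w (s⁻¹ * x) = r x * w x) :
    (weightMeasure w).map (fun x => s * x) =
      (weightMeasure w).withDensity fun x => ENNReal.ofReal (r x) := by
  have hm : Measurable fun x : ℝ => s * x := measurable_const_mul s
  have hW : Measurable fun x => ENNReal.ofReal (w x) := hw.ennreal_ofReal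
  have hR : Measurable fun x => ENNReal.ofReal (r x) := hr.ennreal_ofReal
  ext A hA
  rw [Measure.map_apply hm hA, weightMeasure, withDensity_apply _ (hm hA),
    withDensity_apply _ hA, restrict_withDensity hA, Measure.restrict_restrict (hm hA),
    Measure.restrict_restrict hA, lintegral_withDensity_eq_lintegral_mul _ hW hR]
  have hpre : (fun x : ℝ => s * x) ⁻¹' A ∩ Ioi 0 = (fun x : ℝ => s * x) ⁻¹' (A ∩ Ioi 0) := by
    ext x; simp [hs]
  have hB : MeasurableSet (A ∩ Ioi (0 : ℝ)) := hA.inter measurableSet_Ioi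
  have hW' : Measurable fun x => ENNReal.ofReal (w (s⁻¹ * x)) :=
    hW.comp (measurable_const_mul s⁻¹)
  have key : ∫⁻ x in (fun x : ℝ => s * x) ⁻¹' (A ∩ Ioi 0), ENNReal.ofReal (w x)
      = ∫⁻ y in A ∩ Ioi 0, ENNReal.ofReal (w (s⁻¹ * y)) ∂(Measure.map (fun x => s * x) volume) := by
    rw [setLIntegral_map hB hW' hm]
    refine lintegral_congr fun x => ?_
    rw [inv_mul_cancel_left₀ hs.ne']
  rw [hpre, key, Real.map_volume_mul_left hs.ne', Measure.restrict_smul, lintegral_smul_measure,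
    smul_eq_mul, ← lintegral_const_mul _ hW']
  refine setLIntegral_congr_fun hB fun x hx => ?_
  have hx0 : 0 < x := hx.2
  simp only [Pi.mul_apply]
  rw [abs_of_pos (inv_pos.2 hs), ← ENNReal.ofReal_mul (inv_pos.2 hs).le, h x hx0,
    ENNReal.ofReal_mul (hr0 x hx0), mul_comm]

theorem IsWeight.map_mul {q : ℝ} {w : ℝ → ℝ} (h : IsWeight q w) :
    (weightMeasure w).map (fun x => q * x) =
      (weightMeasure w).withDensity fun x => ENNReal.ofReal (x⁻¹) := by
  refine map_mul_weightMeasure h.measurable h.q_pos measurable_inv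
    (fun x hx => (inv_pos.2 hx).le) fun x hx => ?_
  have hq := h.q_pos
  have := h.func_eq (q⁻¹ * x) (by positivity)
  rw [show q⁻¹ * x * q = x by field_simp] at this
  rw [this]
  field_simp

theorem IsWeight.map_inv_mul {q : ℝ} {w : ℝ → ℝ} (h : IsWeight q w) :
    (weightMeasure w).map (fun x => q⁻¹ * x) =
      (weightMeasure w).withDensity fun x => ENNReal.ofReal (q * x) := by
  have hq := h.q_pos
  refine map_mul_weightMeasure h.measurable (inv_pos.2 hq) (measurable_const_mul q)
    (fun x hx => by positivity) fun x hx => ?_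
  rw [inv_inv, mul_comm q x, h.func_eq x hx]
  ring

theorem quasi_of_map_eq {μ : Measure ℝ} {s : ℝ} {r : ℝ → ENNReal}
    (h : μ.map (fun x => s * x) = μ.withDensity r) :
    Measure.QuasiMeasurePreserving (fun x => s * x) μ μ :=
  ⟨measurable_const_mul s, h ▸ withDensity_absolutelyContinuous _ _⟩

theorem IsWeight.quasi_mul {q : ℝ} {w : ℝ → ℝ} (h : IsWeight q w) :
    Measure.QuasiMeasurePreserving (fun x => x * q) (weightMeasure w) (weightMeasure w) := by
  simpa only [mul_comm] using quasi_of_map_eq h.map_mul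

theorem IsWeight.quasi_div {q : ℝ} {w : ℝ → ℝ} (h : IsWeight q w) :
    Measure.QuasiMeasurePreserving (fun x => x / q) (weightMeasure w) (weightMeasure w) := by
  simpa only [mul_comm, div_eq_mul_inv] using quasi_of_map_eq h.map_inv_mul

theorem memLp_comp_mul {μ : Measure ℝ} {s : ℝ} {r : ℝ → ℝ}
    (h : μ.map (fun x => s * x) = μ.withDensity fun x => ENNReal.ofReal (r x))
    {K : Set ℝ} (hK : MeasurableSet K) {C : ℝ} (hC : ∀ x ∈ K, r x ≤ C)
    {f : ℝ → ℂ} (hf : MemLp f 2 μ) (hfK : ∀ᵐ x ∂μ, x ∉ K → f x = 0) :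
    MemLp (fun x => f (s * x)) 2 μ := by
  have hac : μ.withDensity (fun x => ENNReal.ofReal (r x)) ≪ μ :=
    withDensity_absolutelyContinuous _ _
  have hind : f =ᵐ[μ] K.indicator f := by
    filter_upwards [hfK] with x hx
    by_cases hxK : x ∈ K
    · simp [hxK]
    · simp [hxK, hx hxK]
  have h1 : MemLp f 2 (μ.withDensity fun x => ENNReal.ofReal (r x)) := by
    rw [memLp_congr_ae (hac.ae_le hind), memLp_indicator_iff_restrict hK]
    refine hf.of_measure_le_smul (c := ENNReal.ofReal C) ENNReal.ofReal_ne_top ?_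
    rw [restrict_withDensity hK]
    calc (μ.restrict K).withDensity (fun x => ENNReal.ofReal (r x))
        ≤ (μ.restrict K).withDensity (fun _ => ENNReal.ofReal C) := by
          refine withDensity_mono ?_
          filter_upwards [ae_restrict_mem hK] with x hx
          exact ENNReal.ofReal_le_ofReal (hC x hx)
      _ = ENNReal.ofReal C • μ.restrict K := withDensity_const _
      _ ≤ ENNReal.ofReal C • μ := by
          gcongr
          exact Measure.restrict_le_self
  rw [← h] at h1
  exact h1.comp_of_map (measurable_const_mul s).aemeasurable

theorem IsWeight.memLp_diffExpr {q : ℝ} {w : ℝ → ℝ} (h : IsWeight q w) {f : ℝ → ℂ}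
    (hf : MemLp f 2 (weightMeasure w)) (hc : HasCptSupport w f) :
    MemLp (diffExpr q f) 2 (weightMeasure w) := by
  obtain ⟨K, hK, hK0, hfK⟩ := hc
  have hq := h.q_pos
  have hKm := hK.measurableSet
  obtain ⟨C, hC⟩ : ∃ C : ℝ, ∀ x ∈ K, x⁻¹ ≤ C := by
    have := (hK.image_of_continuousOn (f := fun x : ℝ => x⁻¹)
      (continuousOn_inv₀.mono fun x hx => (hK0 hx).ne')).bddAbove
    obtain ⟨C, hC⟩ := this
    exact ⟨C, fun x hx => hC ⟨x, hx, rfl⟩⟩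
  obtain ⟨D, hD⟩ : ∃ D : ℝ, ∀ x ∈ K, q * x ≤ D := by
    obtain ⟨D, hD⟩ := hK.bddAbove
    exact ⟨q * D, fun x hx => mul_le_mul_of_nonneg_left (hD hx) hq.le⟩
  have h1 : MemLp (fun x => f (x * q)) 2 (weightMeasure w) := by
    simpa only [mul_comm] using memLp_comp_mul h.map_mul hKm hC hf hfK
  have hM : Measurable fun x : ℝ => 1 / (x : ℂ) := by fun_prop
  have h2 : MemLp (fun x : ℝ => 1 / (x : ℂ) * f x) 2 (weightMeasure w) := by
    refine MemLp.of_le_mul (c := C) hf (hM.aestronglyMeasurable.mul hf.1) ?_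
    filter_upwards [hfK] with x hx
    by_cases hxK : x ∈ K
    · have hx0 : 0 < x := hK0 hxK
      rw [norm_mul, norm_div, norm_one, Complex.norm_real, Real.norm_of_nonneg hx0.le, one_div]
      exact mul_le_mul_of_nonneg_right (hC x hxK) (norm_nonneg _)
    · simp [hx hxK]
  have h2K : ∀ᵐ x ∂(weightMeasure w), x ∉ K → 1 / (x : ℂ) * f x = 0 := by
    filter_upwards [hfK] with x hx hxK
    rw [hx hxK, mul_zero]
  have h3 : MemLp (fun x : ℝ => 1 / (x : ℂ) * f (x / q)) 2 (weightMeasure w) := by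
    have h4 := (memLp_comp_mul h.map_inv_mul hKm hD h2 h2K).const_mul ((q : ℂ)⁻¹)
    refine h4.congr_norm ?_ (ae_of_all _ fun x => ?_)
    · refine hM.aestronglyMeasurable.mul ?_
      exact hf.1.comp_quasiMeasurePreserving h.quasi_div
    · congr 1
      have hqc : (q : ℂ) ≠ 0 := by exact_mod_cast hq.ne'
      rw [div_eq_inv_mul x q]
      push_cast
      field_simp
  exact (h1.sub h2).add h3

theorem HasCptSupport.add {w : ℝ → ℝ} {f g : L2 w} (hf : HasCptSupport w f)
    (hg : HasCptSupport w g) : HasCptSupport w (f + g : L2 w) := by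
  obtain ⟨K, hK, hK0, hfK⟩ := hf
  obtain ⟨K', hK', hK0', hgK⟩ := hg
  refine ⟨K ∪ K', hK.union hK', union_subset hK0 hK0', ?_⟩
  filter_upwards [hfK, hgK, Lp.coeFn_add f g] with x h1 h2 h3 hx
  rw [mem_union, not_or] at hx
  rw [h3, Pi.add_apply, h1 hx.1, h2 hx.2, add_zero]

theorem HasCptSupport.smul {w : ℝ → ℝ} (c : ℂ) {f : L2 w} (hf : HasCptSupport w f) :
    HasCptSupport w (c • f : L2 w) := by
  obtain ⟨K, hK, hK0, hfK⟩ := hf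
  refine ⟨K, hK, hK0, ?_⟩
  filter_upwards [hfK, Lp.coeFn_smul c f] with x h1 h3 hx
  rw [h3, Pi.smul_apply, h1 hx, smul_zero]

theorem HasCptSupport.zero (w : ℝ → ℝ) : HasCptSupport w (0 : L2 w) := by
  refine ⟨∅, isCompact_empty, empty_subset _, ?_⟩
  filter_upwards [Lp.coeFn_zero ℂ 2 (weightMeasure w)] with x h1 _
  rw [h1, Pi.zero_apply]

/-- The operator `L` in `L²(μ)` whose domain consists of the compactly supported functions in
`L²(μ)`, given by `(Lf)(x) = f(xq) - f(x)/x + f(x/q)/x`. -/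
def opL {q : ℝ} {w : ℝ → ℝ} (h : IsWeight q w) : L2 w →ₗ.[ℂ] L2 w where
  domain :=
    { carrier := {f | HasCptSupport w f}
      add_mem' := fun hf hg => hf.add hg
      zero_mem' := HasCptSupport.zero w
      smul_mem' := fun c _ hf => hf.smul c }
  toFun :=
    { toFun := fun f => (h.memLp_diffExpr (Lp.memLp f.1) f.2).toLp (diffExpr q f.1)
      map_add' := by
        rintro ⟨f, hf⟩ ⟨g, hg⟩
        rw [← MemLp.toLp_add]
        refine MemLp.toLp_congr _ _ ?_
        have hfg := Lp.coeFn_add f g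
        filter_upwards [hfg, h.quasi_mul.ae hfg, h.quasi_div.ae hfg] with x h1 h2 h3
        simp only [Pi.add_apply, diffExpr] at h1 h2 h3 ⊢
        change (f + g : L2 w) (x * q) - 1 / (x : ℂ) * (f + g : L2 w) x +
          1 / (x : ℂ) * (f + g : L2 w) (x / q) = _
        rw [h1, h2, h3]
        ring
      map_smul' := by
        rintro c ⟨f, hf⟩
        rw [RingHom.id_apply, ← MemLp.toLp_const_smul]
        refine MemLp.toLp_congr _ _ ?_
        have hfg := Lp.coeFn_smul c f
        filter_upwards [hfg, h.quasi_mul.ae hfg, h.quasi_div.ae hfg] with x h1 h2 h3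
        simp only [Pi.smul_apply, diffExpr, smul_eq_mul] at h1 h2 h3 ⊢
        change (c • f : L2 w) (x * q) - 1 / (x : ℂ) * (c • f : L2 w) x +
          1 / (x : ℂ) * (c • f : L2 w) (x / q) = _
        rw [h1, h2, h3]
        ring }

/-! ## The Jacobi operators `J_t` -/

/-- The Hilbert space `ℓ²(ℤ)`. -/
abbrev Ell2 : Type := lp (fun _ : ℤ => ℂ) 2

/-- `a_k(t) = 1/√(t q^{k+1})`. -/
def coeffA (q t : ℝ) (k : ℤ) : ℝ := 1 / Real.sqrt (t * q ^ (k + 1))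

/-- `b_k(t) = -1/(t q^k)`. -/
def coeffB (q t : ℝ) (k : ℤ) : ℝ := -(1 / (t * q ^ k))

/-- The `k`-th coordinate of `J_t v`, i.e. of the linear extension of
`e_k ↦ a_k e_{k+1} + b_k e_k + a_{k-1} e_{k-1}`. -/
def jacobiExpr (q t : ℝ) (v : ℤ → ℂ) (k : ℤ) : ℂ :=
  (coeffA q t k : ℂ) * v (k + 1) + (coeffB q t k : ℂ) * v k
    + (coeffA q t (k - 1) : ℂ) * v (k - 1)

theorem memℓp_jacobiExpr (q t : ℝ) {v : ℤ → ℂ} (hv : v.support.Finite) :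
    Memℓp (jacobiExpr q t v) 2 := by
  refine (memℓp_zero (?_ : Set.Finite {k | jacobiExpr q t v k ≠ 0})).of_exponent_ge zero_le
  refine ((hv.image fun k => k - 1).union (hv.union (hv.image fun k => k + 1))).subset ?_
  intro k hk
  by_contra hcon
  simp only [mem_union, mem_image, Function.mem_support, not_or, not_exists, not_and] at hcon
  obtain ⟨h1, h2, h3⟩ := hcon
  apply hk
  have e1 : v (k + 1) = 0 := by
    by_contra hne
    exact h1 (k + 1) hne (by ring)
  have e3 : v (k - 1) = 0 := by
    by_contra hne
    exact h3 (k - 1) hne (by ring)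
  have e2 : v k = 0 := not_not.1 h2
  simp [jacobiExpr, e1, e2, e3]

/-- The operator `J_t` in `ℓ²(ℤ)`; its domain `𝒟` is the space of finite linear combinations of the
standard basis vectors `e_k`, i.e. of finitely supported sequences. -/
def opJ (q t : ℝ) : Ell2 →ₗ.[ℂ] Ell2 where
  domain :=
    { carrier := {v | (Function.support (v : ℤ → ℂ)).Finite}
      add_mem' := by
        intro v u hv hu
        refine (hv.union hu).subset ?_
        rw [lp.coeFn_add]
        exact Function.support_add _ _
      zero_mem' := by
        have h0 : (Function.support ((0 : Ell2) : ℤ → ℂ)) = ∅ := by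
          rw [lp.coeFn_zero]
          exact Function.support_zero
        simp only [mem_ofPred_eq, h0, finite_empty]
      smul_mem' := by
        intro c v hv
        refine hv.subset ?_
        rw [lp.coeFn_smul]
        exact Function.support_const_smul_subset _ _ }
  toFun :=
    { toFun := fun v => ⟨jacobiExpr q t (v.1 : ℤ → ℂ), memℓp_jacobiExpr q t v.2⟩
      map_add' := by
        intro v u
        ext k
        change jacobiExpr q t ((v.1 + u.1 : Ell2) : ℤ → ℂ) k
          = jacobiExpr q t v.1 k + jacobiExpr q t u.1 k
        simp only [jacobiExpr, lp.coeFn_add, Pi.add_apply]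
        ring
      map_smul' := by
        intro c v
        ext k
        change jacobiExpr q t ((c • v.1 : Ell2) : ℤ → ℂ) k = c * jacobiExpr q t v.1 k
        simp only [jacobiExpr, lp.coeFn_smul, Pi.smul_apply, smul_eq_mul]
        ring }

/-! ## Direct integrals -/

section DirectIntegral

variable {E : Type*} [NormedAddCommGroup E] [NormedSpace ℂ E]

/-- The graph of the direct integral of a field of operators. -/
def directIntegralGraph (ν : Measure ℝ) (A : ℝ → E →ₗ.[ℂ] E) :
    Submodule ℂ (Lp E 2 ν × Lp E 2 ν) where
  carrier := {p | ∀ᵐ t ∂ν, ((p.1 : ℝ → E) t, (p.2 : ℝ → E) t) ∈ (A t).graph}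
  add_mem' := by
    rintro ⟨u, v⟩ ⟨u', v'⟩ h h'
    filter_upwards [h, h', Lp.coeFn_add u u', Lp.coeFn_add v v'] with t h1 h2 h3 h4
    simp only [Prod.mk_add_mk] at h1 h2 ⊢
    rw [h3, h4]
    exact (A t).graph.add_mem h1 h2
  zero_mem' := by
    filter_upwards [Lp.coeFn_zero E 2 ν] with t h1
    simp only [Prod.fst_zero, Prod.snd_zero]
    rw [h1]
    exact (A t).graph.zero_mem
  smul_mem' := by
    rintro c ⟨u, v⟩ h
    filter_upwards [h, Lp.coeFn_smul c u, Lp.coeFn_smul c v] with t h1 h3 h4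
    simp only [Prod.smul_mk] at h1 ⊢
    rw [h3, h4]
    exact (A t).graph.smul_mem c h1

/-- The direct integral `∫^⊕ A_t dν(t)` of a field of (unbounded) operators on a Hilbert space `E`.
It acts in `∫^⊕ E dν(t) = L²(ν; E)`. Its domain consists of the `u` such that `u(t) ∈ dom(A_t)` for
almost every `t` and `t ↦ A_t u(t)` belongs to `L²(ν; E)`; it maps `u` to `t ↦ A_t u(t)`. -/
def directIntegral (ν : Measure ℝ) (A : ℝ → E →ₗ.[ℂ] E) : Lp E 2 ν →ₗ.[ℂ] Lp E 2 ν :=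
  (directIntegralGraph ν A).toLinearPMap

/-- The graph used in the definition of `directIntegral` is indeed its graph. -/
theorem mem_graph_directIntegral (ν : Measure ℝ) (A : ℝ → E →ₗ.[ℂ] E) (u v : Lp E 2 ν) :
    (u, v) ∈ (directIntegral ν A).graph ↔ ∀ᵐ t ∂ν, (u t, v t) ∈ (A t).graph := by
  rw [directIntegral, Submodule.toLinearPMap_graph_eq]
  · rfl
  · rintro ⟨x, y⟩ h hx
    have hx' : x = 0 := hx
    subst hx'
    refine Lp.eq_zero_iff_ae_eq_zero.2 ?_
    filter_upwards [h, Lp.coeFn_zero E 2 ν] with t h1 h2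
    exact (A t).graph_fst_eq_zero_snd h1 (by simpa using h2)

end DirectIntegral

/-- `Ω`, the part of `(q,1]` that carries the measure `μ = w(x) dx`. -/
def omega (q : ℝ) (w : ℝ → ℝ) : Set ℝ := {t | t ∈ Ioc q 1 ∧ 0 < w t}

/-- Lebesgue measure on `Ω`. -/
abbrev omegaMeasure (q : ℝ) (w : ℝ → ℝ) : Measure ℝ := volume.restrict (omega q w)

/-- The direct integral Hilbert space `∫^⊕_Ω ℓ²(ℤ) dt`. -/
abbrev DirectL2 (q : ℝ) (w : ℝ → ℝ) : Type := Lp Ell2 2 (omegaMeasure q w)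

/-- A unitary operator `I : L²(μ) → ∫^⊕_Ω ℓ²(ℤ) dt` extends the map
`(If)(t) = ∑_k f(tq^k) q^{k/2} √(w(tq^k)) e_k`, which is defined on the compactly supported
functions `f`. As those are dense in `L²(μ)`, there is at most one such `I`. -/
def ExtendsI {q : ℝ} {w : ℝ → ℝ} (I : L2 w ≃ₗᵢ[ℂ] DirectL2 q w) : Prop :=
  ∀ f : L2 w, HasCptSupport w f → ∀ᵐ t ∂(omegaMeasure q w), ∀ k : ℤ,
    (I f t : Ell2) k =
      f (t * q ^ k) * ((q ^ ((k : ℝ) / 2) : ℝ) : ℂ) * (Real.sqrt (w (t * q ^ k)) : ℂ)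

/-! ## Operators in Hilbert space -/

section Operators

variable {H K : Type*} [NormedAddCommGroup H] [InnerProductSpace ℂ H]
  [NormedAddCommGroup K] [InnerProductSpace ℂ K]

/-- For a unitary `U : H → K` and an operator `A` in `K`, the operator `U* A U` in `H`, with domain
`{f | U f ∈ dom A}`. -/
def unitaryConj (U : H ≃ₗᵢ[ℂ] K) (A : K →ₗ.[ℂ] K) : H →ₗ.[ℂ] H where
  domain := A.domain.comap (U.toLinearEquiv : H →ₗ[ℂ] K)
  toFun :=
    { toFun := fun f => U.symm (A ⟨U f.1, f.2⟩)
      map_add' := by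
        rintro ⟨f, hf⟩ ⟨g, hg⟩
        rw [← map_add, ← LinearPMap.map_add]
        congr 2
        exact Subtype.ext (map_add U f g)
      map_smul' := by
        rintro c ⟨f, hf⟩
        rw [RingHom.id_apply, ← map_smul, ← LinearPMap.map_smul]
        congr 2
        exact Subtype.ext (map_smul U c f) }

/-- A bounded operator as a (partially defined) operator with domain the whole space. -/
def ofBounded (B : H →L[ℂ] H) : H →ₗ.[ℂ] H := (B : H →ₗ[ℂ] H).toPMap ⊤

end Operators

/-! ## Bounded Borel functional calculus of an unbounded operator -/

/-- The *-algebra of bounded Borel functions `ℝ → ℂ` (with pointwise operations). -/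
def BddBorel : StarSubalgebra ℂ (ℝ → ℂ) where
  carrier := {f | Measurable f ∧ ∃ C : ℝ, ∀ x, ‖f x‖ ≤ C}
  mul_mem' := by
    rintro f g ⟨hf, C, hC⟩ ⟨hg, D, hD⟩
    refine ⟨hf.mul hg, C * D, fun x => ?_⟩
    rw [Pi.mul_apply, norm_mul]
    exact mul_le_mul (hC x) (hD x) (norm_nonneg _) ((norm_nonneg _).trans (hC x))
  add_mem' := by
    rintro f g ⟨hf, C, hC⟩ ⟨hg, D, hD⟩
    exact ⟨hf.add hg, C + D, fun x => (norm_add_le _ _).trans (add_le_add (hC x) (hD x))⟩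
  algebraMap_mem' := fun c => ⟨measurable_const, ‖c‖, fun _ => le_rfl⟩
  star_mem' := by
    rintro f ⟨hf, C, hC⟩
    refine ⟨Complex.continuous_conj.measurable.comp hf, C, fun x => ?_⟩
    rw [Pi.star_apply, norm_star]
    exact hC x

/-- For nonreal `z`, the bounded function `x ↦ 1/(x - z)` on `ℝ`. -/
def resolventFun (z : ℂ) (hz : z.im ≠ 0) : BddBorel :=
  ⟨fun x => 1 / ((x : ℂ) - z), by
    refine ⟨by fun_prop, 1 / |z.im|, fun x => ?_⟩
    have h : |z.im| ≤ ‖(x : ℂ) - z‖ := by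
      simpa using Complex.abs_im_le_norm ((x : ℂ) - z)
    rw [norm_div, norm_one]
    exact one_div_le_one_div_of_le (abs_pos.2 hz) h⟩

section Calculus

variable {H : Type*} [NormedAddCommGroup H] [InnerProductSpace ℂ H] [CompleteSpace H]

/-- `Φ` is the bounded Borel functional calculus `f ↦ f(T)` of the operator `T`: a unital
*-homomorphism from the bounded Borel functions on `ℝ` to the bounded operators which is strongly
continuous under bounded pointwise convergence of sequences, and which maps `x ↦ 1/(x - z)` to
the resolvent `(T - z)⁻¹` for every nonreal `z`. -/
structure IsBorelCalculus (T : H →ₗ.[ℂ] H) (Φ : BddBorel →⋆ₐ[ℂ] (H →L[ℂ] H)) : Prop where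
  tendsto : ∀ (F : ℕ → BddBorel) (f : BddBorel),
    (∃ C : ℝ, ∀ n x, ‖(F n : ℝ → ℂ) x‖ ≤ C) →
    (∀ x, Tendsto (fun n => (F n : ℝ → ℂ) x) atTop (𝓝 ((f : ℝ → ℂ) x))) →
    ∀ u : H, Tendsto (fun n => Φ (F n) u) atTop (𝓝 (Φ f u))
  resolvent_right : ∀ (z : ℂ) (hz : z.im ≠ 0) (v : H),
    ∃ hv : Φ (resolventFun z hz) v ∈ T.domain,
      T ⟨Φ (resolventFun z hz) v, hv⟩ - z • Φ (resolventFun z hz) v = v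
  resolvent_left : ∀ (z : ℂ) (hz : z.im ≠ 0) (u : T.domain),
    Φ (resolventFun z hz) (T u - z • (u : H)) = u

open Classical in
/-- The bounded operator `f(T)`, for an operator `T` that has a bounded Borel functional calculus
(as every self-adjoint operator does, and then exactly one); it is set to `0` for other `T`. -/
def borelCalculus (T : H →ₗ.[ℂ] H) (f : BddBorel) : H →L[ℂ] H :=
  if h : ∃ Φ : BddBorel →⋆ₐ[ℂ] (H →L[ℂ] H), IsBorelCalculus T Φ then h.choose f else 0

end Calculus

end StieltjesWigert

end

noncomputable section

namespace StieltjesWigert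

/-! Cut the half line into the cells `(q^(k+1), q^k]` and rescale each to `(q,1]`. A function `f`
becomes a field of sequences `(f(tq^k))_k`, and `q^k w(tq^k)` is the density of `μ` at the lattice
point. Multiplying by its square root gives the unitary `I`. The equation `w(xq) = x w(x)` is what
turns the q-difference expression into the symmetric Jacobi expression on each fiber
(`IsWeight.latticeSeq_diffExpr`).

Self-adjointness is decided on the fibers. `J_t^*` is the Jacobi expression on its maximal domain.
Since `b_k = -a_{k-1}^2`, dividing `(J_t^* u)_k` by `a_{k-1}` shows that `(a_{k-1} u_k)_k` is square
summable (`summable_coeffA_mul_sq`). Summation by parts then leaves no boundary terms, so `J_t^*` is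
symmetric, hence self-adjoint. Integrating over `t`, the direct integral of the `J_t^*` is
symmetric. Testing against fields with a single nonzero coordinate identifies it with `L^*`
(`IsWeight.adjoint_opL`). A densely defined `T ≤ T^*` with `T^*` symmetric has `T^*` as its only
self-adjoint extension.

The Borel calculus of a self-adjoint `T` comes from the normal operator `R = (T - i)⁻¹`. Its
continuous calculus extends to bounded Borel functions through spectral measures, and is pulled back
along `x ↦ 1/x + i`, which is real on the nonzero spectrum of `R`. Functions `1/(x - z)` generate
all bounded Borel functions under algebra and bounded limits (`BddBorel.induction`). This gives
uniqueness, and it also gives (c): resolvents of `L^*` act fiberwise, and the property passes to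
sums, products and limits. -/

/-! ## A monotone class argument for bounded measurable functions -/

section MonotoneClass

variable {X : Type*}

/-- A class of functions containing the constants, closed under sums, products and limits of
uniformly bounded pointwise convergent sequences. -/
structure IsBoundedlyClosed (P : (X → ℂ) → Prop) : Prop where
  const : ∀ c : ℂ, P fun _ => c
  add : ∀ {f g}, P f → P g → P (f + g)
  mul : ∀ {f g}, P f → P g → P (f * g)
  lim : ∀ {F : ℕ → X → ℂ} {f : X → ℂ} (C : ℝ), (∀ n, P (F n)) → (∀ n x, ‖F n x‖ ≤ C) →
    (∀ x, Tendsto (fun n => F n x) atTop (𝓝 (f x))) → P f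

namespace IsBoundedlyClosed

variable {P : (X → ℂ) → Prop} (hP : IsBoundedlyClosed P)
include hP

theorem sub {f g : X → ℂ} (hf : P f) (hg : P g) : P (f - g) := by
  have := hP.add hf (hP.mul (hP.const (-1)) hg)
  convert this using 1
  ext x
  simp [sub_eq_add_neg]

theorem polynomial {g : X → ℝ} (hg : P fun x => (g x : ℂ)) (p : Polynomial ℝ) :
    P fun x => ((p.eval (g x) : ℝ) : ℂ) := by
  induction p using Polynomial.induction_on' with
  | add p r hp hr =>
    convert hP.add hp hr using 1
    ext x
    simp
  | monomial n a =>
    induction n with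
    | zero => simpa using hP.const a
    | succ n ih =>
      convert hP.mul ih hg using 1
      ext x
      simp [pow_succ, mul_assoc]

/-- Weierstrass: on `[-C, C]` the function `φ` is a uniform limit of polynomials, and polynomials in
`g` stay in the class. -/
theorem comp_continuous {g : X → ℝ} (hg : P fun x => (g x : ℂ)) {C : ℝ} (hC : ∀ x, |g x| ≤ C)
    {φ : ℝ → ℝ} (hφ : Continuous φ) : P fun x => ((φ (g x) : ℝ) : ℂ) := by
  have hmem : ∀ x, g x ∈ Icc (-C) C := fun x => abs_le.1 (hC x)
  choose p hp using fun n : ℕ => exists_polynomial_near_of_continuousOn (-C) C φ hφ.continuousOn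
    (1 / ((n : ℝ) + 1)) (by positivity)
  obtain ⟨D, hD⟩ := isCompact_Icc.exists_bound_of_continuousOn (hφ.continuousOn (s := Icc (-C) C))
  have hdist : ∀ n x, |(p n).eval (g x) - φ (g x)| ≤ 1 / ((n : ℝ) + 1) :=
    fun n x => (hp n _ (hmem x)).le
  refine hP.lim (D + 1) (fun n => hP.polynomial hg (p n)) (fun n x => ?_) fun x => ?_
  · rw [Complex.norm_real]
    have h1 := hdist n x
    have h2 := hD _ (hmem x)
    have h3 : 1 / ((n : ℝ) + 1) ≤ 1 := by
      rw [div_le_one (by positivity)]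
      linarith [(Nat.cast_nonneg n : (0 : ℝ) ≤ n)]
    calc ‖(p n).eval (g x)‖ = ‖φ (g x) + ((p n).eval (g x) - φ (g x))‖ := by ring_nf
      _ ≤ ‖φ (g x)‖ + |(p n).eval (g x) - φ (g x)| := norm_add_le _ _
      _ ≤ D + 1 := by linarith
  · refine (Complex.continuous_ofReal.tendsto _).comp ?_
    rw [tendsto_iff_dist_tendsto_zero]
    exact squeeze_zero (fun _ => dist_nonneg) (fun n => hdist n x)
      tendsto_one_div_add_atTop_nhds_zero_nat

/-- The sets whose indicator function belongs to a boundedly closed class. -/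
@[reducible]
def measurableSpace : MeasurableSpace X where
  MeasurableSet' A := P (A.indicator fun _ => 1)
  measurableSet_empty := by simpa using hP.const 0
  measurableSet_compl A hA := by
    convert hP.sub (hP.const 1) hA using 1
    ext x
    by_cases hx : x ∈ A <;> simp [hx]
  measurableSet_iUnion A hA := by
    -- Finite unions come from `1_(A ∪ B) = 1_A + 1_B - 1_A 1_B`; the countable union is their
    -- bounded pointwise limit.
    have hunion : ∀ n : ℕ, P ({x | ∃ i < n, x ∈ A i}.indicator fun _ => (1 : ℂ)) := by
      intro n
      induction n with
      | zero => simpa using hP.const 0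
      | succ n ih =>
        convert hP.sub (hP.add ih (hA n)) (hP.mul ih (hA n)) using 1
        ext x
        have : (x ∈ {x | ∃ i < n + 1, x ∈ A i}) ↔ (x ∈ {x | ∃ i < n, x ∈ A i}) ∨ x ∈ A n := by
          simp only [mem_ofPred_eq, Nat.lt_succ_iff_lt_or_eq, or_and_right, exists_or, exists_eq_left]
        simp only [Pi.sub_apply, Pi.add_apply, Pi.mul_apply]
        by_cases h1 : x ∈ {x | ∃ i < n, x ∈ A i} <;> by_cases h2 : x ∈ A n <;>
          simp only [h1, h2, or_true, or_false, iff_true, iff_false] at this <;>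
          simp only [indicator, h1, h2, this, if_true, if_false] <;> norm_num
    refine hP.lim 1 hunion (fun n x => ?_) fun x => ?_
    · refine (norm_indicator_le_norm_self _ _).trans (by simp)
    · refine tendsto_const_nhds.congr' ?_
      by_cases hx : x ∈ ⋃ i, A i
      · obtain ⟨i, hi⟩ := mem_iUnion.1 hx
        filter_upwards [eventually_gt_atTop i] with n hn
        have : x ∈ {x | ∃ i < n, x ∈ A i} := ⟨i, hn, hi⟩
        rw [indicator_of_mem hx, indicator_of_mem this]
      · refine Eventually.of_forall fun n => ?_
        have : x ∉ {x | ∃ i < n, x ∈ A i} := fun ⟨i, _, h⟩ => hx (mem_iUnion.2 ⟨i, h⟩)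
        beta_reduce
        rw [indicator_of_notMem hx, indicator_of_notMem this]

/-- The indicator of `{g > c}` is the limit of `min 1 (n * max (g - c) 0)`, which are continuous
functions of `g` bounded by 1. -/
theorem measurable_of_mem {g : X → ℝ} (hg : P fun x => (g x : ℂ)) {C : ℝ} (hC : ∀ x, |g x| ≤ C) :
    Measurable[hP.measurableSpace] g := by
  refine @measurable_of_Ioi _ _ _ _ _ hP.measurableSpace _ _ _ _ fun c => ?_
  change P ((g ⁻¹' Ioi c).indicator fun _ => 1)
  refine hP.lim (F := fun n x => ((min 1 (n * max (g x - c) 0) : ℝ) : ℂ)) 1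
    (fun n => hP.comp_continuous hg hC (φ := fun y => min 1 (n * max (y - c) 0)) (by fun_prop))
    (fun n x => ?_) fun x => ?_
  · rw [Complex.norm_real, Real.norm_of_nonneg (by positivity)]
    exact min_le_left _ _
  · refine tendsto_const_nhds.congr' ?_
    by_cases hx : c < g x
    · obtain ⟨N, hN⟩ := exists_nat_gt (1 / (g x - c))
      filter_upwards [eventually_ge_atTop N] with n hn
      have h0 : 0 < g x - c := sub_pos.2 hx
      have h1 : 1 ≤ n * (g x - c) := by
        rw [div_lt_iff₀ h0] at hN
        have : (N : ℝ) ≤ n := by exact_mod_cast hn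
        nlinarith
      rw [indicator_of_mem (by exact hx), max_eq_left h0.le, min_eq_left h1, Complex.ofReal_one]
    · refine Eventually.of_forall fun n => ?_
      rw [indicator_of_notMem (by exact hx), max_eq_right (by linarith)]
      simp

/-- Simple functions are in the class by construction of the σ-algebra, and `f` is a bounded
pointwise limit of such functions. -/
theorem mem_of_measurable {f : X → ℂ} (hf : Measurable[hP.measurableSpace] f) {C : ℝ}
    (hC : ∀ x, ‖f x‖ ≤ C) : P f := by
  let _ := hP.measurableSpace
  have hfs : StronglyMeasurable f := hf.stronglyMeasurable
  have hsimple : ∀ s : SimpleFunc X ℂ, P s := by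
    intro s
    induction s using SimpleFunc.induction with
    | const c hs =>
      convert hP.mul (hP.const c) hs using 1
      ext x
      rename_i A
      by_cases hx : x ∈ A <;> simp [hx]
    | add _ hf hg => exact hP.add hf hg
  exact hP.lim (|C|) (fun n => hsimple (hfs.approxBounded |C| n))
    (fun n x => hfs.norm_approxBounded_le (abs_nonneg C) n x)
    fun x => hfs.tendsto_approxBounded_of_norm_le ((hC x).trans (le_abs_self C))

/-- A boundedly closed class contains all bounded measurable functions as soon as its bounded real
elements generate the σ-algebra. -/
theorem mem_of_generates [m0 : MeasurableSpace X]
    (hgen : ∀ m : MeasurableSpace X,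
      (∀ g : X → ℝ, P (fun x => (g x : ℂ)) → (∃ C : ℝ, ∀ x, |g x| ≤ C) → Measurable[m] g) → m0 ≤ m)
    {f : X → ℂ} (hf : Measurable f) {C : ℝ} (hC : ∀ x, ‖f x‖ ≤ C) : P f :=
  hP.mem_of_measurable
    (hf.mono (hgen hP.measurableSpace fun _ hg ⟨_, hC⟩ => hP.measurable_of_mem hg hC) le_rfl) hC

/-- In a metric space a proper open set is where the distance to its complement is positive, so
continuous functions generate the Borel σ-algebra. -/
theorem mem_of_continuous_mem [PseudoMetricSpace X] [CompactSpace X] [m0 : MeasurableSpace X]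
    [hB : BorelSpace X] (hcont : ∀ g : C(X, ℂ), P g) {f : X → ℂ} (hf : Measurable f) {C : ℝ}
    (hC : ∀ x, ‖f x‖ ≤ C) : P f := by
  refine hP.mem_of_generates (fun m hm => ?_) hf hC
  have hcont' : ∀ g : X → ℝ, Continuous g → Measurable[m] g := by
    intro g hg
    refine hm g (hcont ⟨fun x => (g x : ℂ), by fun_prop⟩) ?_
    obtain ⟨D, hD⟩ := isCompact_univ.exists_bound_of_continuousOn hg.continuousOn
    exact ⟨D, fun x => hD x (mem_univ x)⟩
  rw [hB.measurable_eq]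
  refine MeasurableSpace.generateFrom_le fun s hs => ?_
  rcases (sᶜ).eq_empty_or_nonempty with h0 | h0
  · rw [compl_empty_iff.1 h0]
    exact @MeasurableSet.univ _ m
  · have h1 := hcont' (fun x => Metric.infDist x sᶜ) (Metric.continuous_infDist_pt _)
    have h2 : s = (fun x => Metric.infDist x sᶜ) ⁻¹' Ioi 0 := by
      ext x
      have := (hs.isClosed_compl).notMem_iff_infDist_pos h0 (x := x)
      rw [mem_preimage, mem_Ioi, ← this, notMem_compl_iff]
    rw [h2]
    exact h1 measurableSet_Ioi

end IsBoundedlyClosed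

end MonotoneClass

/-- Induction principle: the bounded Borel functions on `ℝ` are generated by the functions
`x ↦ 1/(x - z)`, `z` nonreal, under algebraic operations and bounded pointwise limits. -/
theorem BddBorel.induction {P : BddBorel → Prop} (const : ∀ c : ℂ, P (algebraMap ℂ BddBorel c))
    (resolvent : ∀ z hz, P (resolventFun z hz)) (add : ∀ f g, P f → P g → P (f + g))
    (mul : ∀ f g, P f → P g → P (f * g))
    (lim : ∀ (F : ℕ → BddBorel) (f : BddBorel), (∀ n, P (F n)) →
      (∃ C : ℝ, ∀ n x, ‖(F n : ℝ → ℂ) x‖ ≤ C) →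
      (∀ x, Tendsto (fun n => (F n : ℝ → ℂ) x) atTop (𝓝 ((f : ℝ → ℂ) x))) → P f)
    (f : BddBorel) : P f := by
  have hP : IsBoundedlyClosed fun g : ℝ → ℂ => ∃ h : g ∈ BddBorel, P ⟨g, h⟩ :=
    { const := fun c => ⟨(algebraMap ℂ BddBorel c).2, const c⟩
      add := fun ⟨hf, hf'⟩ ⟨hg, hg'⟩ => ⟨add_mem hf hg, add _ _ hf' hg'⟩
      mul := fun ⟨hf, hf'⟩ ⟨hg, hg'⟩ => ⟨mul_mem hf hg, mul _ _ hf' hg'⟩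
      lim := by
        intro F f C hF hC hlim
        have hf : f ∈ BddBorel :=
          ⟨measurable_of_tendsto_metrizable (fun n => (hF n).1.1) (tendsto_pi_nhds.2 hlim), C,
            fun x => le_of_tendsto (hlim x).norm (Eventually.of_forall fun n => hC n x)⟩
        exact ⟨hf, lim (fun n => ⟨F n, (hF n).1⟩) ⟨f, hf⟩ (fun n => (hF n).2) ⟨C, hC⟩ hlim⟩ }
  have hI : (Complex.I).im ≠ 0 := by simp
  have hI' : (-Complex.I).im ≠ 0 := by simp
  have hne : ∀ x : ℝ, (x : ℂ) - Complex.I ≠ 0 ∧ (x : ℂ) + Complex.I ≠ 0 := fun x =>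
    ⟨fun h => by simpa using congrArg Complex.im h, fun h => by simpa using congrArg Complex.im h⟩
  have hsq : ∀ x : ℝ, (x : ℂ) ^ 2 + 1 = (x - Complex.I) * (x + Complex.I) := fun x => by
    linear_combination Complex.I_sq
  -- The product and the half sum of `1/(x - i)` and `1/(x + i)` are real and bounded. Their
  -- quotient is the identity, so a σ-algebra making both measurable contains all Borel sets.
  have hs : (fun x : ℝ => ((1 / (x ^ 2 + 1) : ℝ) : ℂ))
      = (resolventFun _ hI : ℝ → ℂ) * (resolventFun _ hI' : ℝ → ℂ) := by
    ext x
    obtain ⟨h1, h2⟩ := hne x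
    simp only [resolventFun, Pi.mul_apply, sub_neg_eq_add]
    push_cast
    rw [hsq]
    field_simp
  have hr : (fun x : ℝ => ((x / (x ^ 2 + 1) : ℝ) : ℂ))
      = (fun _ => (1 / 2 : ℂ)) * ((resolventFun _ hI : ℝ → ℂ) + (resolventFun _ hI' : ℝ → ℂ)) := by
    ext x
    obtain ⟨h1, h2⟩ := hne x
    simp only [resolventFun, Pi.mul_apply, Pi.add_apply, sub_neg_eq_add]
    push_cast
    rw [hsq]
    field_simp
    ring
  have hRI : ∃ h : (resolventFun _ hI : ℝ → ℂ) ∈ BddBorel, P ⟨_, h⟩ :=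
    ⟨(resolventFun _ hI).2, resolvent _ hI⟩
  have hRI' : ∃ h : (resolventFun _ hI' : ℝ → ℂ) ∈ BddBorel, P ⟨_, h⟩ :=
    ⟨(resolventFun _ hI').2, resolvent _ hI'⟩
  obtain ⟨hf, C, hC⟩ := f.2
  refine (hP.mem_of_generates (fun m hm => ?_) hf hC).2
  have hs' : Measurable[m, Real.measurableSpace] fun x : ℝ => 1 / (x ^ 2 + 1) := by
    refine hm _ (hs ▸ hP.mul hRI hRI') ⟨1, fun x => ?_⟩
    rw [abs_of_nonneg (by positivity), div_le_one (by positivity)]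
    nlinarith [sq_nonneg x]
  have hr' : Measurable[m, Real.measurableSpace] fun x : ℝ => x / (x ^ 2 + 1) := by
    refine hm _ (hr ▸ hP.mul (hP.const _) (hP.add hRI hRI')) ⟨1, fun x => ?_⟩
    rw [abs_div, abs_of_nonneg (by positivity : (0 : ℝ) ≤ x ^ 2 + 1), div_le_one (by positivity)]
    nlinarith [sq_nonneg (|x| - 1), sq_abs x]
  have hdiv : ∀ (_ : MeasurableSpace ℝ) {f g : ℝ → ℝ}, Measurable[_, Real.measurableSpace] f →
      Measurable[_, Real.measurableSpace] g →
      Measurable[_, Real.measurableSpace] fun x => f x / g x := fun _ _ _ hf hg =>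
    measurable_div.comp (hf.prodMk hg)
  have hid : Measurable[m, Real.measurableSpace] (id : ℝ → ℝ) := by
    have : (id : ℝ → ℝ) = fun x => (x / (x ^ 2 + 1)) / (1 / (x ^ 2 + 1)) := by
      ext x
      have : x ^ 2 + 1 ≠ 0 := by positivity
      simp only [id]
      field_simp
    rw [this]
    exact hdiv m hr' hs'
  exact fun s hs => hid hs

section Calculus

variable {H : Type*} [NormedAddCommGroup H] [InnerProductSpace ℂ H] [CompleteSpace H]

/-- A right inverse and a left inverse of `T - z` coincide, so the two calculi agree on resolvents,
which generate everything. -/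
theorem IsBorelCalculus.unique {T : H →ₗ.[ℂ] H} {Φ Ψ : BddBorel →⋆ₐ[ℂ] (H →L[ℂ] H)}
    (hΦ : IsBorelCalculus T Φ) (hΨ : IsBorelCalculus T Ψ) : Φ = Ψ := by
  ext1 f
  induction f using BddBorel.induction with
  | const c => rw [AlgHomClass.commutes Φ, AlgHomClass.commutes Ψ]
  | resolvent z hz =>
    ext v
    obtain ⟨hv, h1⟩ := hΦ.resolvent_right z hz v
    have h2 := hΨ.resolvent_left z hz ⟨_, hv⟩
    rw [h1] at h2
    exact h2.symm
  | add f g hf hg => rw [map_add, map_add, hf, hg]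
  | mul f g hf hg => rw [map_mul, map_mul, hf, hg]
  | lim F f hF hC hlim =>
    ext u
    refine tendsto_nhds_unique (hΦ.tendsto F f hC hlim u) ?_
    simp only [hF]
    exact hΨ.tendsto F f hC hlim u

theorem IsBorelCalculus.borelCalculus_eq {T : H →ₗ.[ℂ] H} {Φ : BddBorel →⋆ₐ[ℂ] (H →L[ℂ] H)}
    (hΦ : IsBorelCalculus T Φ) (f : BddBorel) : borelCalculus T f = Φ f := by
  have h : ∃ Φ : BddBorel →⋆ₐ[ℂ] (H →L[ℂ] H), IsBorelCalculus T Φ := ⟨Φ, hΦ⟩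
  rw [borelCalculus, dif_pos h, h.choose_spec.unique hΦ]

end Calculus

/-! ## Extending a representation of `C(X)` to bounded Borel functions -/

section BorelExtension

/-- Bounded measurable complex functions. -/
structure IsBddMeasurable {X : Type*} [MeasurableSpace X] (f : X → ℂ) : Prop where
  measurable : Measurable f
  bounded : ∃ C : ℝ, ∀ x, ‖f x‖ ≤ C

section BddMeasurable

variable {X : Type*} [MeasurableSpace X] {f g : X → ℂ}

theorem IsBddMeasurable.add (hf : IsBddMeasurable f) (hg : IsBddMeasurable g) :
    IsBddMeasurable (f + g) := by
  obtain ⟨C, hC⟩ := hf.bounded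
  obtain ⟨D, hD⟩ := hg.bounded
  exact ⟨hf.1.add hg.1, C + D, fun x => (norm_add_le _ _).trans (add_le_add (hC x) (hD x))⟩

theorem IsBddMeasurable.mul (hf : IsBddMeasurable f) (hg : IsBddMeasurable g) :
    IsBddMeasurable (f * g) := by
  obtain ⟨C, hC⟩ := hf.bounded
  obtain ⟨D, hD⟩ := hg.bounded
  refine ⟨hf.1.mul hg.1, C * D, fun x => ?_⟩
  rw [Pi.mul_apply, norm_mul]
  exact mul_le_mul (hC x) (hD x) (norm_nonneg _) ((norm_nonneg _).trans (hC x))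

theorem isBddMeasurable_const (c : ℂ) : IsBddMeasurable fun _ : X => c :=
  ⟨measurable_const, ‖c‖, fun _ => le_rfl⟩

theorem IsBddMeasurable.star (hf : IsBddMeasurable f) : IsBddMeasurable (star f) := by
  obtain ⟨C, hC⟩ := hf.bounded
  exact ⟨Complex.continuous_conj.measurable.comp hf.1, C, fun x => by
    rw [Pi.star_apply, norm_star]; exact hC x⟩

theorem IsBddMeasurable.of_tendsto {F : ℕ → X → ℂ} {C : ℝ} (hF : ∀ n, IsBddMeasurable (F n))
    (hC : ∀ n x, ‖F n x‖ ≤ C) (h : ∀ x, Tendsto (fun n => F n x) atTop (𝓝 (f x))) :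
    IsBddMeasurable f :=
  ⟨measurable_of_tendsto_metrizable (fun n => (hF n).1) (tendsto_pi_nhds.2 h), C,
    fun x => le_of_tendsto (h x).norm (Eventually.of_forall fun n => hC n x)⟩

theorem IsBddMeasurable.memLp (hf : IsBddMeasurable f) (ν : Measure X) [IsFiniteMeasure ν] :
    MemLp f 2 ν := by
  obtain ⟨C, hC⟩ := hf.bounded
  exact MemLp.of_bound hf.1.aestronglyMeasurable C (ae_of_all _ hC)

theorem norm_toLp_sq {ν : Measure X} {f : X → ℂ} (hf : MemLp f 2 ν) :
    ‖hf.toLp f‖ ^ 2 = ∫ x, ‖f x‖ ^ 2 ∂ν := by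
  rw [← inner_self_eq_norm_sq (𝕜 := ℂ), L2.inner_def]
  rw [← integral_re (L2.integrable_inner _ _)]
  refine integral_congr_ae ?_
  filter_upwards [hf.coeFn_toLp] with x hx
  rw [hx, inner_self_eq_norm_sq]

/-- Dominated convergence for `‖F n - f‖ ^ 2`, with the constant `(2C)^2` as majorant. -/
theorem tendsto_toLp_of_bounded {ν : Measure X} [IsFiniteMeasure ν] {F : ℕ → X → ℂ} {C : ℝ}
    (hF : ∀ n, MemLp (F n) 2 ν) (hf : MemLp f 2 ν) (hC : ∀ n x, ‖F n x‖ ≤ C)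
    (h : ∀ x, Tendsto (fun n => F n x) atTop (𝓝 (f x))) :
    Tendsto (fun n => (hF n).toLp (F n)) atTop (𝓝 (hf.toLp f)) := by
  rw [tendsto_iff_norm_sub_tendsto_zero]
  have h1 : ∀ n, ‖(hF n).toLp (F n) - hf.toLp f‖ ^ 2 = ∫ x, ‖F n x - f x‖ ^ 2 ∂ν := by
    intro n
    rw [← MemLp.toLp_sub, norm_toLp_sq]
    rfl
  have h2 : Tendsto (fun n => ∫ x, ‖F n x - f x‖ ^ 2 ∂ν) atTop (𝓝 (∫ _, (0 : ℝ) ∂ν)) := by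
    refine tendsto_integral_of_dominated_convergence (fun _ => (2 * C) ^ 2)
      (fun n => (((hF n).1.sub hf.1).norm.pow 2)) (integrable_const _)
      (fun n => ae_of_all _ fun x => ?_) (ae_of_all _ fun x => ?_)
    · have h3 : ‖f x‖ ≤ C := le_of_tendsto (h x).norm (Eventually.of_forall fun n => hC n x)
      rw [norm_pow, norm_norm]
      gcongr
      calc ‖F n x - f x‖ ≤ ‖F n x‖ + ‖f x‖ := norm_sub_le _ _
        _ ≤ 2 * C := by linarith [hC n x]
    · have := ((tendsto_sub_nhds_zero_iff.2 (h x)).norm).pow 2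
      simpa using this
  rw [integral_zero] at h2
  have h3 := h2.sqrt
  rw [Real.sqrt_zero] at h3
  refine h3.congr fun n => ?_
  rw [← h1, Real.sqrt_sq (norm_nonneg _)]

end BddMeasurable

variable {X : Type*} [MetricSpace X]
variable {H : Type*} [NormedAddCommGroup H] [InnerProductSpace ℂ H] [CompleteSpace H]

/-- A real continuous function as a complex one. -/
def complexify (g : C(X, ℝ)) : C(X, ℂ) := ⟨fun x => (g x : ℂ), by fun_prop⟩

/-- Exhibits `⟨u, φ(g)u⟩` as nonnegative when `g` has the form `star s * s`; this is the positivity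
needed for Riesz–Markov. -/
theorem norm_sq_map (φ : C(X, ℂ) →⋆ₐ[ℂ] (H →L[ℂ] H)) (g : C(X, ℂ)) (u : H) :
    ‖φ g u‖ ^ 2 = (inner ℂ u (φ (star g * g) u)).re := by
  rw [map_mul, map_star, mul_apply_eq_comp, ContinuousLinearMap.star_eq_adjoint,
    ContinuousLinearMap.adjoint_inner_right]
  exact (inner_self_eq_norm_sq (𝕜 := ℂ) _).symm

variable [CompactSpace X] [MeasurableSpace X] [BorelSpace X]

theorem isBddMeasurable_continuousMap (g : C(X, ℂ)) : IsBddMeasurable g :=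
  ⟨g.continuous.measurable, ‖g‖, g.norm_coe_le_norm⟩

/-- The spectral measure of a vector. -/
theorem exists_spectral_measure (φ : C(X, ℂ) →⋆ₐ[ℂ] (H →L[ℂ] H)) (u : H) :
    ∃ ν : Measure X, ν.Regular ∧ IsFiniteMeasure ν ∧
      ∀ g : C(X, ℂ), ∫ x, ‖g x‖ ^ 2 ∂ν = ‖φ g u‖ ^ 2 := by
  let Λ : CompactlySupportedContinuousMap X ℝ →ₚ[ℝ] ℝ := PositiveLinearMap.mk₀
    { toFun := fun g => (inner ℂ u (φ (complexify g.toContinuousMap) u)).re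
      map_add' := by
        intro f g
        have : complexify (f + g).toContinuousMap
            = complexify f.toContinuousMap + complexify g.toContinuousMap := by
          ext x; simp [complexify]
        rw [this, map_add, add_apply, inner_add_right, Complex.add_re]
      map_smul' := by
        intro c g
        have : complexify (c • g).toContinuousMap = (c : ℂ) • complexify g.toContinuousMap := by
          ext x; simp [complexify]
        rw [this, map_smul, smul_apply, inner_smul_right]
        simp }
    (by
      intro g hg
      let s : C(X, ℂ) := ⟨fun x => (Real.sqrt (g x) : ℂ), by fun_prop⟩
      have : complexify g.toContinuousMap = star s * s := by
        ext x
        have h0 : 0 ≤ g x := hg x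
        change (g x : ℂ) = star (Real.sqrt (g x) : ℂ) * (Real.sqrt (g x) : ℂ)
        rw [Complex.star_def, Complex.conj_ofReal, ← Complex.ofReal_mul, Real.mul_self_sqrt h0]
      change 0 ≤ (inner ℂ u (φ (complexify g.toContinuousMap) u)).re
      rw [this, ← norm_sq_map]
      positivity)
  refine ⟨RealRMK.rieszMeasure Λ, inferInstance, inferInstance, fun g => ?_⟩
  let g' : CompactlySupportedContinuousMap X ℝ :=
    ⟨⟨fun x => ‖g x‖ ^ 2, by fun_prop⟩, HasCompactSupport.of_compactSpace _⟩
  have h1 := RealRMK.integral_rieszMeasure Λ g'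
  have h2 : complexify g'.toContinuousMap = star g * g := by
    ext x
    change ((‖g x‖ ^ 2 : ℝ) : ℂ) = star (g x) * g x
    rw [Complex.star_def, Complex.conj_mul']
    push_cast
    rfl
  have h3 : Λ g' = ‖φ g u‖ ^ 2 := by
    rw [norm_sq_map, ← h2]
    rfl
  rw [← h3, ← h1]
  rfl

/-- The properties of the map `f ↦ f(φ) u` on bounded Borel functions. -/
structure IsCyclicMap (φ : C(X, ℂ) →⋆ₐ[ℂ] (H →L[ℂ] H)) (u : H) (A : (X → ℂ) → H) : Prop where
  apply_continuous : ∀ g : C(X, ℂ), A g = φ g u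
  add : ∀ {f g}, IsBddMeasurable f → IsBddMeasurable g → A (f + g) = A f + A g
  continuous_mul : ∀ (g : C(X, ℂ)) {f}, IsBddMeasurable f → A ((g : X → ℂ) * f) = φ g (A f)
  lim : ∀ {F : ℕ → X → ℂ} {f : X → ℂ} (C : ℝ), (∀ n, IsBddMeasurable (F n)) →
    (∀ n x, ‖F n x‖ ≤ C) → (∀ x, Tendsto (fun n => F n x) atTop (𝓝 (f x))) →
    Tendsto (fun n => A (F n)) atTop (𝓝 (A f))

/-- The norm of `φ(g)u` is the `L²(ν)` norm of `g` for the spectral measure `ν` of `u`. Hence `g ↦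
φ(g)u` extends from the dense subspace `C(X)` to a bounded map `W` on `L²(ν)`, and `A f` is `W` of
the class of `f`. The value 0 off `L²(ν)` is never used. -/
theorem exists_isCyclicMap (φ : C(X, ℂ) →⋆ₐ[ℂ] (H →L[ℂ] H)) (u : H) :
    ∃ A : (X → ℂ) → H, IsCyclicMap φ u A := by
  obtain ⟨ν, hreg, hfin, hν⟩ := exists_spectral_measure φ u
  let e : C(X, ℂ) →L[ℂ] Lp ℂ 2 ν := ContinuousMap.toLp 2 ν ℂ
  have he : DenseRange e := ContinuousMap.toLp_denseRange ℂ ν ℂ (by simp)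
  have hee : ∀ g : C(X, ℂ), e g = ((isBddMeasurable_continuousMap g).memLp ν).toLp g :=
    fun g => rfl
  let a : C(X, ℂ) →ₗ[ℂ] H :=
    { toFun := fun g => φ g u
      map_add' := fun f g => by rw [map_add, add_apply]
      map_smul' := fun c f => by
        rw [map_smul, smul_apply, RingHom.id_apply] }
  have hnorm : ∀ g, ‖a g‖ ≤ 1 * ‖e g‖ := by
    intro g
    rw [one_mul]
    refine le_of_sq_le_sq ?_ (norm_nonneg _)
    rw [hee, norm_toLp_sq]
    exact (hν g).symm.le
  let W : Lp ℂ 2 ν →L[ℂ] H := a.extendOfNorm e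
  have hW : ∀ g, W (e g) = φ g u := fun g => LinearMap.extendOfNorm_eq he ⟨1, hnorm⟩ g
  classical
  have hA : ∀ f (hf : IsBddMeasurable f), (if h : MemLp f 2 ν then W (h.toLp f) else 0)
      = W ((hf.memLp ν).toLp f) := fun f hf => dif_pos (hf.memLp ν)
  refine ⟨fun f => if h : MemLp f 2 ν then W (h.toLp f) else 0, ?_, ?_, ?_, ?_⟩
  · intro g
    rw [hA _ (isBddMeasurable_continuousMap g), ← hee, hW]
  · intro f g hf hg
    rw [hA _ hf, hA _ hg, hA _ (hf.add hg), ← map_add, ← MemLp.toLp_add]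
  · intro g f hf
    have hgf := (isBddMeasurable_continuousMap g).mul hf
    rw [hA _ hf, hA _ hgf]
    -- For continuous `f` the claim is multiplicativity of `φ`. Approximating `f` by continuous
    -- functions in `L²(ν)` suffices, as multiplication by `g` is bounded there.
    obtain ⟨s, hs, hs'⟩ := mem_closure_iff_seq_limit.1 (he ((hf.memLp ν).toLp f))
    choose p hp using hs
    have h1 : Tendsto (fun n => e (g * p n)) atTop (𝓝 ((hgf.memLp ν).toLp (g * f))) := by
      rw [tendsto_iff_norm_sub_tendsto_zero] at hs' ⊢
      refine squeeze_zero (fun _ => norm_nonneg _) (fun n => ?_)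
        (by simpa using hs'.const_mul ‖g‖)
      rw [← hp, hee, hee, ← MemLp.toLp_sub, ← MemLp.toLp_sub]
      refine Lp.norm_le_mul_norm_of_ae_le_mul ?_
      filter_upwards [MemLp.coeFn_toLp (((isBddMeasurable_continuousMap (g * p n)).memLp ν).sub
        (hgf.memLp ν)), MemLp.coeFn_toLp (((isBddMeasurable_continuousMap (p n)).memLp ν).sub
        (hf.memLp ν))] with x hx hx'
      rw [hx, hx']
      simp only [Pi.sub_apply, ContinuousMap.coe_mul, Pi.mul_apply]
      rw [← mul_sub, norm_mul]
      exact mul_le_mul_of_nonneg_right (g.norm_coe_le_norm x) (norm_nonneg _)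
    refine tendsto_nhds_unique ((W.continuous.tendsto _).comp h1) ?_
    refine (((φ g).continuous.comp W.continuous).tendsto _ |>.comp hs').congr fun n => ?_
    simp only [Function.comp_apply]
    rw [← hp, hW, hW, map_mul, mul_apply_eq_comp]
  · intro F f C hF hC h
    have hf := IsBddMeasurable.of_tendsto hF hC h
    rw [hA _ hf]
    simp only [hA _ (hF _)]
    exact (W.continuous.tendsto _).comp (tendsto_toLp_of_bounded _ _ hC h)

/-- `Ψ` extends the representation `φ` of `C(X)` to the bounded Borel functions on `X`. -/
structure IsBorelExtension (φ : C(X, ℂ) →⋆ₐ[ℂ] (H →L[ℂ] H)) (Ψ : (X → ℂ) → (H →L[ℂ] H)) :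
    Prop where
  apply_continuous : ∀ g : C(X, ℂ), Ψ g = φ g
  add : ∀ {f g}, IsBddMeasurable f → IsBddMeasurable g → Ψ (f + g) = Ψ f + Ψ g
  mul : ∀ {f g}, IsBddMeasurable f → IsBddMeasurable g → Ψ (f * g) = Ψ f * Ψ g
  lim : ∀ {F : ℕ → X → ℂ} {f : X → ℂ} (C : ℝ), (∀ n, IsBddMeasurable (F n)) →
    (∀ n x, ‖F n x‖ ≤ C) → (∀ x, Tendsto (fun n => F n x) atTop (𝓝 (f x))) →
    ∀ u, Tendsto (fun n => Ψ (F n) u) atTop (𝓝 (Ψ f u))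

/-- The functions `f` for which multiplication by `f` is implemented by one operator, the same for
all `u`, form a boundedly closed class containing `C(X)`. Such an operator sends `u = A u 1` to `A u
f`, so it is determined by `f`. -/
theorem exists_isBorelExtension (φ : C(X, ℂ) →⋆ₐ[ℂ] (H →L[ℂ] H)) :
    ∃ Ψ : (X → ℂ) → (H →L[ℂ] H), IsBorelExtension φ Ψ := by
  choose A hA using exists_isCyclicMap φ
  have key : ∀ f : X → ℂ, IsBddMeasurable f →
      ∃ T : H →L[ℂ] H, ∀ u g, IsBddMeasurable g → A u (f * g) = T (A u g) := by
    have hP : IsBoundedlyClosed fun f : X → ℂ => IsBddMeasurable f ∧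
        ∃ T : H →L[ℂ] H, ∀ u g, IsBddMeasurable g → A u (f * g) = T (A u g) :=
      { const := fun c => ⟨isBddMeasurable_const c, φ (ContinuousMap.const X c),
          fun u g hg => (hA u).continuous_mul (ContinuousMap.const X c) hg⟩
        add := by
          rintro f g ⟨hf, S, hS⟩ ⟨hg, T, hT⟩
          refine ⟨hf.add hg, S + T, fun u k hk => ?_⟩
          rw [add_mul, (hA u).add (hf.mul hk) (hg.mul hk), hS u k hk, hT u k hk,
            add_apply]
        mul := by
          rintro f g ⟨hf, S, hS⟩ ⟨hg, T, hT⟩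
          refine ⟨hf.mul hg, S * T, fun u k hk => ?_⟩
          rw [mul_assoc, hS u _ (hg.mul hk), hT u k hk, mul_apply_eq_comp]
        lim := by
          intro F f C hF hC h
          have hf := IsBddMeasurable.of_tendsto (fun n => (hF n).1) hC h
          choose T hT using fun n => (hF n).2
          have hlim : ∀ u g, IsBddMeasurable g →
              Tendsto (fun n => T n (A u g)) atTop (𝓝 (A u (f * g))) := by
            intro u g hg
            obtain ⟨D, hD⟩ := hg.bounded
            refine ((hA u).lim (F := fun n => F n * g) (f := f * g) (C * D)
              (fun n => (hF n).1.mul hg) (fun n x => ?_) fun x => ?_).congr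
              fun n => hT n u g hg
            · rw [Pi.mul_apply, norm_mul]
              exact mul_le_mul (hC n x) (hD x) (norm_nonneg _) ((norm_nonneg _).trans (hC n x))
            · exact (h x).mul_const _
          -- Every vector `u` is of the form `A u 1`, so `hlim` yields convergence of `T n` at every
          -- vector.
          have hone : ∀ u, A u (1 : C(X, ℂ)) = u := by
            intro u
            rw [(hA u).apply_continuous, map_one, one_apply_eq_self]
          have hlim1 : Tendsto (fun n u => T n u) atTop
              (𝓝 fun u => A u (f * (1 : C(X, ℂ)))) := by
            rw [tendsto_pi_nhds]
            intro u
            have := hlim u _ (isBddMeasurable_continuousMap 1)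
            rwa [hone] at this
          -- Banach–Steinhaus: the pointwise limit of the `T n` is bounded.
          refine ⟨hf, continuousLinearMapOfTendsto T hlim1, fun u g hg => ?_⟩
          refine tendsto_nhds_unique (hlim u g hg) ?_
          exact tendsto_pi_nhds.1 hlim1 (A u g) }
    intro f hf
    obtain ⟨C, hC⟩ := hf.bounded
    refine (hP.mem_of_continuous_mem (fun g => ?_) hf.1 hC).2
    exact ⟨isBddMeasurable_continuousMap g, φ g, fun u f hf => (hA u).continuous_mul g hf⟩
  choose T hT using key
  classical
  have hone : IsBddMeasurable (1 : X → ℂ) := isBddMeasurable_const 1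
  have hone' : ∀ u, A u 1 = u := by
    intro u
    have := (hA u).apply_continuous 1
    rwa [map_one, one_apply_eq_self] at this
  have hTA : ∀ f hf u, T f hf u = A u f := by
    intro f hf u
    have := hT f hf u 1 hone
    rw [mul_one, hone'] at this
    exact this.symm
  have hΨ : ∀ f (hf : IsBddMeasurable f), (if h : IsBddMeasurable f then T f h else 0) = T f hf :=
    fun f hf => dif_pos hf
  refine ⟨fun f => if h : IsBddMeasurable f then T f h else 0, ?_, ?_, ?_, ?_⟩
  · intro g
    rw [hΨ _ (isBddMeasurable_continuousMap g)]
    ext u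
    rw [hTA, (hA u).apply_continuous]
  · intro f g hf hg
    rw [hΨ _ hf, hΨ _ hg, hΨ _ (hf.add hg)]
    ext u
    rw [add_apply, hTA, hTA, hTA, (hA u).add hf hg]
  · intro f g hf hg
    rw [hΨ _ hf, hΨ _ hg, hΨ _ (hf.mul hg)]
    ext u
    rw [mul_apply_eq_comp, hTA _ hg, ← hT, hTA]
    exact hg
  · intro F f C hF hC h u
    simp only [hΨ _ (hF _), hΨ _ (IsBddMeasurable.of_tendsto hF hC h), hTA]
    exact (hA u).lim C hF hC h

/-- Monotone class again. Taking adjoints is not strongly continuous, so the limit step compares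
matrix coefficients. -/
theorem IsBorelExtension.apply_star {φ : C(X, ℂ) →⋆ₐ[ℂ] (H →L[ℂ] H)} {Ψ : (X → ℂ) → (H →L[ℂ] H)}
    (hΨ : IsBorelExtension φ Ψ) {f : X → ℂ} (hf : IsBddMeasurable f) :
    Ψ (star f) = star (Ψ f) := by
  have hP : IsBoundedlyClosed fun f : X → ℂ => IsBddMeasurable f ∧ Ψ (star f) = star (Ψ f) :=
    { const := by
        intro c
        refine ⟨isBddMeasurable_const c, ?_⟩
        have h1 := hΨ.apply_continuous (ContinuousMap.const X c)
        have h2 := hΨ.apply_continuous (Star.star (ContinuousMap.const X c))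
        rw [map_star, ← h1] at h2
        exact h2
      add := by
        rintro f g ⟨hf, hf'⟩ ⟨hg, hg'⟩
        refine ⟨hf.add hg, ?_⟩
        rw [star_add, hΨ.add hf.star hg.star, hΨ.add hf hg, hf', hg', star_add]
      mul := by
        rintro f g ⟨hf, hf'⟩ ⟨hg, hg'⟩
        refine ⟨hf.mul hg, ?_⟩
        rw [star_mul, hΨ.mul hg.star hf.star, hΨ.mul hf hg, hf', hg', star_mul]
      lim := by
        intro F f C hF hC h
        have hf := IsBddMeasurable.of_tendsto (fun n => (hF n).1) hC h
        refine ⟨hf, ?_⟩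
        rw [ContinuousLinearMap.star_eq_adjoint, ContinuousLinearMap.eq_adjoint_iff]
        intro u v
        have h1 := hΨ.lim (F := fun n => Star.star (F n)) (f := Star.star f) C
          (fun n => (hF n).1.star)
          (fun n x => by rw [Pi.star_apply, norm_star]; exact hC n x)
          (fun x => (Complex.continuous_conj.tendsto _).comp (h x)) u
        have h2 := hΨ.lim C (fun n => (hF n).1) hC h v
        refine tendsto_nhds_unique (h1.inner tendsto_const_nhds)
          ((tendsto_const_nhds.inner h2).congr fun n => ?_)
        rw [(hF n).2, ContinuousLinearMap.star_eq_adjoint, ContinuousLinearMap.adjoint_inner_left] }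
  obtain ⟨C, hC⟩ := hf.bounded
  refine (hP.mem_of_continuous_mem (fun g => ?_) hf.1 hC).2
  refine ⟨isBddMeasurable_continuousMap g, ?_⟩
  have h2 := hΨ.apply_continuous (Star.star g)
  rw [map_star, ← hΨ.apply_continuous g] at h2
  exact h2

end BorelExtension

/-! ## Self-adjoint operators: resolvents and the Borel functional calculus -/

section SelfAdjoint

variable {H : Type*} [NormedAddCommGroup H] [InnerProductSpace ℂ H]

/-- The bounded operator `R` is the resolvent `(T - z)⁻¹`. -/
def IsResolvent (T : H →ₗ.[ℂ] H) (z : ℂ) (R : H →L[ℂ] H) : Prop :=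
  ∀ u v, R v = u ↔ (u, v + z • u) ∈ T.graph

namespace IsResolvent

variable {T : H →ₗ.[ℂ] H} {z ζ : ℂ} {R S : H →L[ℂ] H}

theorem mem_graph (hR : IsResolvent T z R) (v : H) : (R v, v + z • R v) ∈ T.graph :=
  (hR _ _).1 rfl

theorem apply_eq (hR : IsResolvent T z R) {u v : H} (h : (u, v) ∈ T.graph) :
    R (v - z • u) = u :=
  (hR _ _).2 (by rwa [sub_add_cancel])

theorem eq_zero_of_apply_eq_zero (hR : IsResolvent T z R) {v : H} (h : R v = 0) : v = 0 := by
  have h1 := hR.mem_graph v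
  rw [h, smul_zero, add_zero] at h1
  exact T.graph_fst_eq_zero_snd h1 rfl

theorem exists_apply_sub (hR : IsResolvent T z R) (v : H) :
    ∃ hv : R v ∈ T.domain, T ⟨R v, hv⟩ - z • R v = v := by
  obtain ⟨y, hy, hy'⟩ := (T.mem_graph_iff).1 (hR.mem_graph v)
  obtain ⟨y, hyd⟩ := y
  simp only at hy hy'
  subst hy
  exact ⟨hyd, by rw [hy', add_sub_cancel_right]⟩

/-- The resolvent identity. -/
theorem sub_eq (hR : IsResolvent T z R) (hS : IsResolvent T ζ S) :
    R - S = (z - ζ) • (R * S) := by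
  ext v
  have h1 := hR.apply_eq (hS.mem_graph v)
  rw [add_sub_assoc, ← sub_smul, map_add, map_smul] at h1
  simp only [sub_apply, smul_apply, mul_apply_eq_comp]
  rw [← neg_sub ζ z, neg_smul, eq_sub_of_add_eq' h1, neg_sub]

end IsResolvent

theorem _root_.IsSelfAdjoint.mem_graph_iff [CompleteSpace H] {T : H →ₗ.[ℂ] H}
    (hT : IsSelfAdjoint T) {u v : H} :
    (u, v) ∈ T.graph ↔ ∀ a b, (a, b) ∈ T.graph → inner ℂ b u = inner ℂ a v := by
  have h1 := LinearPMap.adjoint_graph_eq_graph_adjoint hT.dense_domain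
  rw [LinearPMap.isSelfAdjoint_def.1 hT] at h1
  conv_lhs => rw [h1, Submodule.mem_adjoint_iff]
  simp only [sub_eq_zero]

theorem _root_.IsSelfAdjoint.inner_graph [CompleteSpace H] {T : H →ₗ.[ℂ] H}
    (hT : IsSelfAdjoint T) {a b u v : H} (h : (a, b) ∈ T.graph) (h' : (u, v) ∈ T.graph) :
    inner ℂ b u = inner ℂ a v :=
  hT.mem_graph_iff.1 h' a b h

/-- Since `⟨u, v⟩` is real, the imaginary part of `⟨u, v - zu⟩` is `-(Im z)‖u‖²`; then
Cauchy–Schwarz. -/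
theorem _root_.IsSelfAdjoint.norm_le_of_mem_graph [CompleteSpace H] {T : H →ₗ.[ℂ] H}
    (hT : IsSelfAdjoint T) {u v : H} (h : (u, v) ∈ T.graph) (z : ℂ) :
    |z.im| * ‖u‖ ≤ ‖v - z • u‖ := by
  have h1 : (inner ℂ u v).im = 0 := by
    have h2 := hT.inner_graph h h
    rw [← inner_conj_symm] at h2
    exact Complex.conj_eq_iff_im.1 h2
  have h2 : (inner ℂ u (v - z • u)).im = -(z.im * ‖u‖ ^ 2) := by
    rw [inner_sub_right, inner_smul_right, inner_self_eq_norm_sq_to_K, Complex.sub_im, h1,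
      zero_sub]
    have : ((‖u‖ : ℂ)) ^ 2 = ((‖u‖ ^ 2 : ℝ) : ℂ) := by push_cast; rfl
    simp only [Complex.coe_algebraMap, this, Complex.im_mul_ofReal]
  have h3 : |z.im| * ‖u‖ ^ 2 ≤ ‖u‖ * ‖v - z • u‖ := by
    calc |z.im| * ‖u‖ ^ 2 = |(inner ℂ u (v - z • u)).im| := by
          rw [h2, abs_neg, abs_mul, abs_of_nonneg (sq_nonneg ‖u‖)]
      _ ≤ ‖inner ℂ u (v - z • u)‖ := Complex.abs_im_le_norm _
      _ ≤ _ := norm_inner_le_norm _ _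
  rcases eq_or_lt_of_le (norm_nonneg u) with h0 | h0
  · rw [← h0, mul_zero]
    exact norm_nonneg _
  · refine le_of_mul_le_mul_left ?_ h0
    linarith

/-- The lower bound makes `T - z` injective and, as `T` is closed, gives it closed range. A vector
orthogonal to the range is an eigenvector for the conjugate of `z`, or zero, and the same bound
forces zero. -/
theorem _root_.IsSelfAdjoint.exists_isResolvent [CompleteSpace H] {T : H →ₗ.[ℂ] H}
    (hT : IsSelfAdjoint T) {z : ℂ} (hz : z.im ≠ 0) : ∃ R : H →L[ℂ] H, IsResolvent T z R := by
  have hz0 : 0 < |z.im| := abs_pos.2 hz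
  let S : T.domain →ₗ[ℂ] H := T.toFun - z • T.domain.subtype
  have hSgr : ∀ u : T.domain, ((u : H), T u) ∈ T.graph := fun u => T.mem_graph u
  have hSap : ∀ u : T.domain, S u = T u - z • (u : H) := fun u => rfl
  have hbd : ∀ u : T.domain, |z.im| * ‖u‖ ≤ ‖S u‖ := fun u =>
    hT.norm_le_of_mem_graph (hSgr u) z
  have hinj : Function.Injective S := by
    rw [← LinearMap.ker_eq_bot, LinearMap.ker_eq_bot']
    intro u hu
    have := hbd u
    rw [hu, norm_zero] at this
    exact norm_le_zero_iff.1 (le_of_mul_le_mul_left (by linarith) hz0)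
  have hclosed : IsClosed (LinearMap.range S : Set H) := by
    refine IsSeqClosed.isClosed fun y y₀ hy hlim => ?_
    choose x hx using hy
    have hcau : CauchySeq x := by
      have h1 : CauchySeq (S ∘ x) := by
        have : S ∘ x = y := funext hx
        rw [this]
        exact hlim.cauchySeq
      rw [Metric.cauchySeq_iff'] at h1 ⊢
      intro ε hε
      obtain ⟨N, hN⟩ := h1 (|z.im| * ε) (by positivity)
      refine ⟨N, fun n hn => ?_⟩
      have h2 := hN n hn
      have h3 := hbd (x n - x N)
      rw [map_sub] at h3
      rw [Function.comp_apply, Function.comp_apply, dist_eq_norm] at h2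
      rw [dist_eq_norm]
      exact lt_of_mul_lt_mul_left (h3.trans_lt h2) hz0.le
    obtain ⟨x₀, hx₀⟩ : ∃ x₀ : H, Tendsto (fun n => (x n : H)) atTop (𝓝 x₀) :=
      cauchySeq_tendsto_of_complete (hcau.map uniformContinuous_subtype_val)
    have h1 : Tendsto (fun n => ((x n : H), T (x n))) atTop (𝓝 (x₀, y₀ + z • x₀)) := by
      refine hx₀.prodMk_nhds ((hlim.add (hx₀.const_smul z)).congr fun n => ?_)
      rw [← hx, hSap]
      exact sub_add_cancel _ _
    have h2 : (x₀, y₀ + z • x₀) ∈ T.graph :=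
      hT.isClosed.mem_of_tendsto h1 (Eventually.of_forall fun n => hSgr (x n))
    obtain ⟨w, hw, hw'⟩ := T.mem_graph_iff.1 h2
    refine ⟨w, ?_⟩
    simp only at hw hw'
    rw [hSap, hw', hw, add_sub_cancel_right]
  have hrange : LinearMap.range S = ⊤ := by
    have : CompleteSpace (LinearMap.range S) := hclosed.completeSpace_coe
    rw [← Submodule.orthogonal_eq_bot_iff, Submodule.eq_bot_iff]
    intro v hv
    rw [Submodule.mem_orthogonal] at hv
    have h1 : (v, (starRingEnd ℂ) z • v) ∈ T.graph := by
      refine hT.mem_graph_iff.2 fun a b hab => ?_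
      obtain ⟨y, hy, hy'⟩ := T.mem_graph_iff.1 hab
      have h2 := hv (S y) ⟨y, rfl⟩
      simp only at hy hy'
      rw [hSap, hy, hy', inner_sub_left, inner_smul_left, sub_eq_zero] at h2
      rw [h2, inner_smul_right]
    have h2 := hT.norm_le_of_mem_graph h1 ((starRingEnd ℂ) z)
    rw [sub_self, norm_zero, Complex.conj_im, abs_neg] at h2
    exact norm_le_zero_iff.1 (le_of_mul_le_mul_left (by linarith) hz0)
  let e : T.domain ≃ₗ[ℂ] H := LinearEquiv.ofBijective S ⟨hinj, LinearMap.range_eq_top.1 hrange⟩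
  have he : ∀ v, T (e.symm v) - z • (e.symm v : H) = v := fun v => e.apply_symm_apply v
  refine ⟨(T.domain.subtype ∘ₗ (e.symm : H →ₗ[ℂ] T.domain)).mkContinuous |z.im|⁻¹ fun v => ?_,
    fun u v => ⟨?_, fun h => ?_⟩⟩
  · have h1 := hbd (e.symm v)
    rw [hSap, he] at h1
    rw [← div_eq_inv_mul, le_div_iff₀' hz0]
    exact h1
  · rintro rfl
    have h1 := hSgr (e.symm v)
    rw [eq_add_of_sub_eq (he v)] at h1
    exact h1
  · obtain ⟨y, hy, hy'⟩ := T.mem_graph_iff.1 h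
    simp only at hy hy'
    have h1 : e y = v := by
      change T y - z • (y : H) = v
      rw [hy', hy, add_sub_cancel_right]
    change ((e.symm v : T.domain) : H) = u
    rw [← h1, e.symm_apply_apply, hy]

theorem IsResolvent.adjoint_eq [CompleteSpace H] {T : H →ₗ.[ℂ] H} (hT : IsSelfAdjoint T) {z : ℂ}
    {R S : H →L[ℂ] H} (hR : IsResolvent T z R) (hS : IsResolvent T ((starRingEnd ℂ) z) S) :
    star R = S := by
  rw [ContinuousLinearMap.star_eq_adjoint]
  symm
  rw [ContinuousLinearMap.eq_adjoint_iff]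
  intro u v
  have h1 := hT.inner_graph (hS.mem_graph u) (hR.mem_graph v)
  rw [inner_add_left, inner_add_right, inner_smul_left, inner_smul_right, Complex.conj_conj] at h1
  exact (add_right_cancel h1).symm

/-- The resolvent identity `R - R^* = 2i R R^* = 2i R^* R` makes `R = (T - i)⁻¹` normal. On its
spectrum it reads `x - x̄ = 2i|x|²`, so `1/x + i` is real for `x ≠ 0`, and `f(T)` can be defined as
`f(1/x + i)` evaluated at `R`. -/
theorem _root_.IsSelfAdjoint.exists_isBorelCalculus [CompleteSpace H] {T : H →ₗ.[ℂ] H}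
    (hT : IsSelfAdjoint T) :
    ∃ Φ : BddBorel →⋆ₐ[ℂ] (H →L[ℂ] H), IsBorelCalculus T Φ := by
  have hI : Complex.I.im ≠ 0 := by simp
  obtain ⟨R, hR⟩ := hT.exists_isResolvent hI
  obtain ⟨R', hR'⟩ := hT.exists_isResolvent (z := (starRingEnd ℂ) Complex.I) (by simp)
  have hstar : star R = R' := hR.adjoint_eq hT hR'
  have hRR : R - star R = (2 * Complex.I) • (R * star R) := by
    rw [hstar, hR.sub_eq hR', Complex.conj_I, sub_neg_eq_add, two_mul]
  have hRR' : R - star R = (2 * Complex.I) • (star R * R) := by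
    rw [hstar, ← neg_sub, hR'.sub_eq hR, Complex.conj_I, ← neg_smul]
    congr 1
    ring
  have hnormal : IsStarNormal R := by
    refine ⟨?_⟩
    have h2 : (2 * Complex.I) ≠ 0 := by simp
    exact smul_right_injective _ h2 (hRR'.symm.trans hRR)
  let X := spectrum ℂ R
  let φ : C(X, ℂ) →⋆ₐ[ℂ] (H →L[ℂ] H) := cfcHom (R := ℂ) hnormal
  let ι : C(X, ℂ) := (ContinuousMap.id ℂ).restrict X
  have hι : φ ι = R := cfcHom_id hnormal
  obtain ⟨Ψ, hΨ⟩ := exists_isBorelExtension φ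
  have hιeq : ι - star ι = (2 * Complex.I) • (ι * star ι) := by
    refine cfcHom_injective (R := ℂ) hnormal ?_
    change φ _ = φ _
    rw [map_sub, map_smul, map_mul, map_star, hι, hRR]
  -- Equals `1/x + i` for `x ≠ 0`; at a possible spectral point 0 it takes the value 0, which is
  -- harmless by `hN`.
  let κ : X → ℝ := fun x => ((x : ℂ)⁻¹).re
  have hκm : Measurable κ := by
    have : Measurable fun x : X => (x : ℂ)⁻¹ := measurable_subtype_coe.inv
    exact Complex.measurable_re.comp this
  have hκ : ∀ x : X, (x : ℂ) ≠ 0 → (κ x : ℂ) - Complex.I = (x : ℂ)⁻¹ := by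
    intro x hx
    have h1 : (x : ℂ) - star (x : ℂ) = (2 * Complex.I) * ((x : ℂ) * star (x : ℂ)) :=
      DFunLike.congr_fun hιeq x
    have hx' : star (x : ℂ) ≠ 0 := star_ne_zero.2 hx
    have h2 : star (x : ℂ)⁻¹ - (x : ℂ)⁻¹ = 2 * Complex.I := by
      rw [star_inv₀]
      field_simp
      rw [h1]
      ring
    have h3 : ((x : ℂ)⁻¹).im = -1 := by
      have := congrArg Complex.im h2
      simp only [Complex.star_def, Complex.sub_im, Complex.conj_im, Complex.mul_im, Complex.I_im,
        Complex.I_re] at this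
      norm_num at this
      simp only [Complex.inv_im]
      linarith
    apply Complex.ext
    · simp [κ]
    · rw [h3]
      simp
  have hcomp : ∀ f : BddBorel, IsBddMeasurable ((f : ℝ → ℂ) ∘ κ) := fun f =>
    ⟨f.2.1.comp hκm, f.2.2.imp fun C hC x => hC _⟩
  let Φ : BddBorel →⋆ₐ[ℂ] (H →L[ℂ] H) :=
    { toFun := fun f => Ψ ((f : ℝ → ℂ) ∘ κ)
      map_one' := (hΨ.apply_continuous 1).trans (map_one φ)
      map_mul' := fun f g => hΨ.mul (hcomp f) (hcomp g)
      map_zero' := (hΨ.apply_continuous 0).trans (map_zero φ)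
      map_add' := fun f g => hΨ.add (hcomp f) (hcomp g)
      commutes' := fun c =>
        (hΨ.apply_continuous (algebraMap ℂ C(X, ℂ) c)).trans (AlgHomClass.commutes φ c)
      map_star' := fun f => hΨ.apply_star (hcomp f) }
  let N : X → ℂ := {x : X | (x : ℂ) = 0}.indicator fun _ => 1
  have hNm : IsBddMeasurable N := by
    refine ⟨measurable_const.indicator (measurable_subtype_coe (measurableSet_singleton 0)), 1,
      fun x => (norm_indicator_le_norm_self _ _).trans (by simp)⟩
  -- The point 0 carries no spectral mass: `R * Ψ N = 0` because `x N(x) = 0`, and `R` is injective.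
  have hN : Ψ N = 0 := by
    have h1 : Ψ ((ι : X → ℂ) * N) = R * Ψ N := by
      rw [hΨ.mul (isBddMeasurable_continuousMap ι) hNm, hΨ.apply_continuous, hι]
    have h2 : (ι : X → ℂ) * N = ((0 : C(X, ℂ)) : X → ℂ) := by
      ext x
      by_cases hx : (x : ℂ) = 0
      · have : ι x = 0 := hx
        simp [this]
      · have : N x = 0 := indicator_of_notMem (show x ∉ {x : X | (x : ℂ) = 0} from hx) _
        simp [this]
    rw [h2, hΨ.apply_continuous, map_zero] at h1
    ext v
    exact hR.eq_zero_of_apply_eq_zero (DFunLike.congr_fun h1.symm v)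
  have hres : ∀ z hz, IsResolvent T z (Φ (resolventFun z hz)) := by
    intro z hz
    obtain ⟨S, hS⟩ := hT.exists_isResolvent hz
    suffices h : Φ (resolventFun z hz) = S by rwa [h]
    let c : ℂ := (resolventFun z hz : ℝ → ℂ) 0
    let p : C(X, ℂ) := 1 + (Complex.I - z) • ι
    -- For `x = 1/(κ - i)` the factor `1 + (i - z)x` equals `(κ - z)/(κ - i)`. The term with `c`
    -- corrects the value at `x = 0`.
    have h1 : ((resolventFun z hz : ℝ → ℂ) ∘ κ) * (p : X → ℂ)
        = (ι : X → ℂ) + ((ContinuousMap.const X c : C(X, ℂ)) : X → ℂ) * N := by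
      ext x
      have hp : p x = 1 + (Complex.I - z) * (x : ℂ) := rfl
      have hιx : ι x = (x : ℂ) := rfl
      simp only [Pi.mul_apply, Pi.add_apply, hp, hιx, Function.comp_apply,
        ContinuousMap.const_apply]
      by_cases hx : (x : ℂ) = 0
      · have h2 : N x = 1 := indicator_of_mem (show x ∈ {x : X | (x : ℂ) = 0} from hx) _
        have h3 : κ x = 0 := by simp [κ, hx]
        rw [h2, h3, hx]
        simp [c]
      · have h2 : N x = 0 := indicator_of_notMem (show x ∉ {x : X | (x : ℂ) = 0} from hx) _
        have h3 : (κ x : ℂ) - z ≠ 0 := fun h => hz (by simpa using congrArg Complex.im h)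
        have h4 : (κ x : ℂ) = (x : ℂ)⁻¹ + Complex.I := by rw [← hκ x hx]; ring
        have h5 : (resolventFun z hz : ℝ → ℂ) (κ x) = 1 / ((κ x : ℂ) - z) := rfl
        rw [h2, h5, mul_zero, add_zero, div_mul_eq_mul_div, div_eq_iff h3, h4, one_mul]
        field_simp
        ring
    have h2 : Φ (resolventFun z hz) * (1 + (Complex.I - z) • R) = R := by
      have h3 := congrArg Ψ h1
      rw [hΨ.mul (hcomp _) (isBddMeasurable_continuousMap p),
        hΨ.add (isBddMeasurable_continuousMap ι) ((isBddMeasurable_continuousMap _).mul hNm),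
        hΨ.mul (isBddMeasurable_continuousMap _) hNm, hN, mul_zero, add_zero,
        hΨ.apply_continuous, hΨ.apply_continuous, hι, map_add, map_one, map_smul, hι] at h3
      exact h3
    have h3 : (z - Complex.I) • (R * S) = S - R := by
      rw [← neg_sub R S, hR.sub_eq hS, ← neg_smul, neg_sub]
    have h4 : (1 + (Complex.I - z) • R) * (1 + (z - Complex.I) • S) = 1 := by
      rw [add_mul, one_mul, mul_add, mul_one, smul_mul_assoc, mul_smul_comm, h3,
        ← neg_sub z Complex.I, neg_smul, neg_smul, smul_sub]
      abel
    calc Φ (resolventFun z hz)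
        = Φ (resolventFun z hz) * (1 + (Complex.I - z) • R) * (1 + (z - Complex.I) • S) := by
          rw [mul_assoc, h4, mul_one]
      _ = S := by
          rw [h2, mul_add, mul_one, mul_smul_comm, h3, add_sub_cancel]
  refine ⟨Φ, ?_, fun z hz v => (hres z hz).exists_apply_sub v, fun z hz u => ?_⟩
  · rintro F f ⟨C, hC⟩ h u
    exact hΨ.lim C (fun n => hcomp (F n)) (fun n x => hC n _) (fun x => h _) u
  · exact (hres z hz).apply_eq (T.mem_graph u)

theorem _root_.IsSelfAdjoint.existsUnique_isBorelCalculus [CompleteSpace H] {T : H →ₗ.[ℂ] H}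
    (hT : IsSelfAdjoint T) :
    ∃! Φ : BddBorel →⋆ₐ[ℂ] (H →L[ℂ] H), IsBorelCalculus T Φ := by
  obtain ⟨Φ, hΦ⟩ := hT.exists_isBorelCalculus
  exact ⟨Φ, hΦ, fun Ψ hΨ => hΨ.unique hΦ⟩

end SelfAdjoint

/-! ## Essentially self-adjoint operators -/

section EssentiallySelfAdjoint

variable {H : Type*} [NormedAddCommGroup H] [InnerProductSpace ℂ H] [CompleteSpace H]

theorem mem_graph_adjoint_iff {T : H →ₗ.[ℂ] H} (hd : Dense (T.domain : Set H)) {u v : H} :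
    (u, v) ∈ T.adjoint.graph ↔ ∀ a b, (a, b) ∈ T.graph → inner ℂ b u = inner ℂ a v := by
  rw [LinearPMap.adjoint_graph_eq_graph_adjoint hd, Submodule.mem_adjoint_iff]
  simp only [sub_eq_zero]

/-- From `T ≤ T^*` one gets `T^** ≤ T^*`, and symmetry of `T^*` is the reverse inclusion. -/
theorem isSelfAdjoint_adjoint {T : H →ₗ.[ℂ] H} (hd : Dense (T.domain : Set H))
    (hle : T ≤ T.adjoint)
    (hsymm : ∀ a b u v, (a, b) ∈ T.adjoint.graph → (u, v) ∈ T.adjoint.graph →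
      inner ℂ b u = inner ℂ a v) : IsSelfAdjoint T.adjoint := by
  have hd' : Dense (T.adjoint.domain : Set H) := hd.mono hle.1
  rw [LinearPMap.isSelfAdjoint_def]
  refine LinearPMap.eq_of_eq_graph ?_
  ext ⟨u, v⟩
  rw [mem_graph_adjoint_iff hd']
  refine ⟨fun h => ?_, fun h a b hab => hsymm a b u v hab h⟩
  rw [mem_graph_adjoint_iff hd]
  exact fun a b hab => h a b (LinearPMap.le_graph_of_le hle hab)

/-- Taking adjoints in `T ≤ A` gives `A ≤ T^*`, and once more gives `T^* ≤ A`. -/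
theorem eq_adjoint_of_isSelfAdjoint {T A : H →ₗ.[ℂ] H} (hT : IsSelfAdjoint T.adjoint)
    (hd : Dense (T.domain : Set H)) (hA : IsSelfAdjoint A) (hTA : T ≤ A) : A = T.adjoint := by
  have h1 : A.graph ≤ T.adjoint.graph := by
    rintro ⟨u, v⟩ huv
    rw [mem_graph_adjoint_iff hd]
    exact fun a b hab => hA.inner_graph (LinearPMap.le_graph_of_le hTA hab) huv
  refine LinearPMap.eq_of_eq_graph (le_antisymm h1 ?_)
  rintro ⟨u, v⟩ huv
  rw [hA.mem_graph_iff]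
  exact fun a b hab => hT.inner_graph (h1 hab) huv

end EssentiallySelfAdjoint

/-! ## The Jacobi operators -/

section Jacobi

variable {q t : ℝ}

theorem single_mem_opJ_domain (k : ℤ) (c : ℂ) : lp.single 2 k c ∈ (opJ q t).domain := by
  refine (finite_singleton k).subset fun j hj => ?_
  by_contra hne
  exact hj (lp.single_apply_ne (E := fun _ : ℤ => ℂ) 2 k c hne)

theorem dense_opJ_domain (q t : ℝ) : Dense ((opJ q t).domain : Set Ell2) := fun v =>
  mem_closure_of_tendsto (lp.hasSum_single (by simp) v)
    (Eventually.of_forall fun s => sum_mem fun k _ => single_mem_opJ_domain k _)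

theorem mem_opJ_graph {u v : Ell2} :
    (u, v) ∈ (opJ q t).graph ↔
      (Function.support (u : ℤ → ℂ)).Finite ∧ ∀ k, v k = jacobiExpr q t u k := by
  rw [LinearPMap.mem_graph_iff]
  constructor
  · rintro ⟨⟨y, hy⟩, h1, h2⟩
    simp only at h1 h2
    subst h1 h2
    exact ⟨hy, fun k => rfl⟩
  · rintro ⟨h1, h2⟩
    refine ⟨⟨u, h1⟩, rfl, ?_⟩
    ext k
    exact (h2 k).symm

/-- Summation by parts for the Jacobi difference expression. -/
theorem tsum_jacobiExpr_comm {x y : ℤ → ℂ}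
    (h1 : Summable fun k => (coeffA q t k : ℂ) * (y (k + 1) * star (x k)))
    (h2 : Summable fun k => (coeffA q t k : ℂ) * (y k * star (x (k + 1))))
    (h3 : Summable fun k => (coeffB q t k : ℂ) * (y k * star (x k))) :
    ∑' k, y k * star (jacobiExpr q t x k) = ∑' k, jacobiExpr q t y k * star (x k) := by
  have e1 : ∀ k, y k * star (jacobiExpr q t x k)
      = (coeffA q t k : ℂ) * (y k * star (x (k + 1))) + (coeffB q t k : ℂ) * (y k * star (x k))
        + (coeffA q t (k - 1) : ℂ) * (y (k - 1 + 1) * star (x (k - 1))) := by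
    intro k
    simp only [jacobiExpr, star_add, star_mul', Complex.star_def, Complex.conj_ofReal,
      sub_add_cancel]
    ring
  have e2 : ∀ k, jacobiExpr q t y k * star (x k)
      = (coeffA q t k : ℂ) * (y (k + 1) * star (x k)) + (coeffB q t k : ℂ) * (y k * star (x k))
        + (coeffA q t (k - 1) : ℂ) * (y (k - 1) * star (x (k - 1 + 1))) := by
    intro k
    simp only [jacobiExpr, sub_add_cancel]
    ring
  have h1' := (Equiv.subRight (1 : ℤ)).summable_iff.2 h1
  have h2' := (Equiv.subRight (1 : ℤ)).summable_iff.2 h2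
  have t1 := (Equiv.subRight (1 : ℤ)).tsum_eq
    fun k => (coeffA q t k : ℂ) * (y (k + 1) * star (x k))
  have t2 := (Equiv.subRight (1 : ℤ)).tsum_eq
    fun k => (coeffA q t k : ℂ) * (y k * star (x (k + 1)))
  simp only [Function.comp_def, Equiv.subRight_apply] at h1' h2' t1 t2
  simp only [e1, e2]
  rw [(h2.add h3).tsum_add h1', h2.tsum_add h3, (h1.add h3).tsum_add h2', h1.tsum_add h3, t1, t2]
  ring

theorem inner_eq_tsum (u v : Ell2) : inner ℂ u v = ∑' k, v k * star (u k) :=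
  lp.inner_eq_tsum u v

/-- As `a` has finite support, summation by parts is legitimate for every `u`, whether or not `u` is
in the maximal domain. -/
theorem inner_opJ {a b u : Ell2} (hab : (a, b) ∈ (opJ q t).graph) :
    inner ℂ b u = ∑' k, jacobiExpr q t u k * star (a k) := by
  obtain ⟨ha, hb⟩ := mem_opJ_graph.1 hab
  rw [inner_eq_tsum]
  simp only [hb]
  refine tsum_jacobiExpr_comm ?_ ?_ ?_
  · refine summable_of_hasFiniteSupport (ha.subset fun k hk h => hk ?_)
    simp only
    rw [h, star_zero, mul_zero, mul_zero]
  · refine summable_of_hasFiniteSupport ((ha.image fun k => k - 1).subset fun k hk => ?_)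
    refine ⟨k + 1, fun h => hk ?_, by ring⟩
    simp only
    rw [h, star_zero, mul_zero, mul_zero]
  · refine summable_of_hasFiniteSupport (ha.subset fun k hk h => hk ?_)
    simp only
    rw [h, star_zero, mul_zero, mul_zero]

/-- The adjoint of `J_t` is the maximal operator given by the Jacobi difference expression. -/
theorem mem_graph_adjoint_opJ {u v : Ell2} :
    (u, v) ∈ (opJ q t).adjoint.graph ↔ ∀ k, v k = jacobiExpr q t u k := by
  rw [mem_graph_adjoint_iff (dense_opJ_domain q t)]
  constructor
  · intro h k
    let e : (opJ q t).domain := ⟨lp.single 2 k (1 : ℂ), single_mem_opJ_domain k 1⟩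
    have h1 := (opJ q t).mem_graph e
    have h2 := h _ _ h1
    have hsum : ∀ f : ℤ → ℂ, ∑' j, f j * star ((e : Ell2) j) = f k := by
      intro f
      rw [tsum_eq_single k]
      · have : (e : Ell2) k = 1 := lp.single_apply_self 2 k 1
        rw [this, star_one, mul_one]
      · intro j hj
        have : (e : Ell2) j = 0 := lp.single_apply_ne 2 k 1 hj
        rw [this, star_zero, mul_zero]
    rw [inner_opJ h1, inner_eq_tsum, hsum, hsum] at h2
    exact h2.symm
  · intro h a b hab
    rw [inner_opJ hab, inner_eq_tsum]
    simp only [h]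

theorem opJ_le_adjoint (q t : ℝ) : opJ q t ≤ (opJ q t).adjoint := by
  refine LinearPMap.le_of_le_graph ?_
  rintro ⟨u, v⟩ huv
  exact mem_graph_adjoint_opJ.2 (mem_opJ_graph.1 huv).2

theorem coeffA_eq_mul (hq : 0 < q) (ht : 0 < t) (k : ℤ) :
    coeffA q t k = (Real.sqrt q)⁻¹ * coeffA q t (k - 1) := by
  rw [coeffA, coeffA, sub_add_cancel, zpow_add_one₀ hq.ne', ← mul_assoc,
    Real.sqrt_mul (by positivity)]
  field_simp

/-- The special relation between diagonal and off-diagonal behind essential self-adjointness. -/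
theorem coeffB_eq_neg_sq (hq : 0 < q) (ht : 0 < t) (k : ℤ) :
    coeffB q t k = -(coeffA q t (k - 1)) ^ 2 := by
  rw [coeffA, coeffB, sub_add_cancel, div_pow, Real.sq_sqrt (by positivity), one_pow]

theorem coeffA_pos (hq : 0 < q) (ht : 0 < t) (k : ℤ) : 0 < coeffA q t k := by
  rw [coeffA]
  positivity

theorem coeffA_mono (hq : 0 < q) (hq1 : q ≤ 1) (ht : 0 < t) : Monotone (coeffA q t) := by
  intro i j hij
  rw [coeffA, coeffA]
  have : q ^ (j + 1) ≤ q ^ (i + 1) := zpow_le_zpow_right_of_le_one₀ hq hq1 (by lia)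
  gcongr

theorem summable_norm_sq (u : Ell2) : Summable fun k => ‖u k‖ ^ 2 := by
  have h := (lp.memℓp u).summable (by simp)
  simpa using h

/-- Elements of the maximal domain of `J_t` lie in the form domain of the diagonal part. -/
theorem summable_coeffA_mul_sq (hq : 0 < q) (hq1 : q ≤ 1) (ht : 0 < t) {u v : Ell2}
    (h : ∀ k, v k = jacobiExpr q t u k) :
    Summable fun k => (coeffA q t (k - 1) * ‖u k‖) ^ 2 := by
  let s : ℤ → ℝ := fun k => coeffA q t (k - 1)
  have hs : ∀ k, 0 < s k := fun k => coeffA_pos hq ht _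
  -- As `s` is increasing, `s 0` bounds `s k` for `k ≤ 0` and `(s 0)⁻¹` bounds `(s k)⁻¹` for `k ≥
  -- 0`; the other two bounds are for the coefficients of `u (k + 1)` and `u (k - 1)`.
  obtain ⟨C, hC1, hC2, hC3, hC4⟩ : ∃ C : ℝ, (s 0)⁻¹ ≤ C ∧ (Real.sqrt q)⁻¹ ≤ C ∧ 1 ≤ C ∧ s 0 ≤ C :=
    ⟨max (max (s 0)⁻¹ (Real.sqrt q)⁻¹) (max 1 (s 0)), by simp, by simp, by simp, by simp⟩
  have hC : 0 ≤ C := zero_le_one.trans hC3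
  have key : ∀ k, s k * ‖u k‖ ≤ C * (‖v k‖ + ‖u (k + 1)‖ + ‖u k‖ + ‖u (k - 1)‖) := by
    intro k
    rcases le_total k 0 with hk | hk
    · have h1 : s k ≤ C := (coeffA_mono hq hq1 ht (by lia)).trans hC4
      calc s k * ‖u k‖ ≤ C * ‖u k‖ := by gcongr
        _ ≤ _ := by
          gcongr
          linarith [norm_nonneg (v k), norm_nonneg (u (k + 1)), norm_nonneg (u (k - 1))]
    · have h1 : s 0 ≤ s k := coeffA_mono hq hq1 ht (by lia)
      have hne : (s k : ℂ) ≠ 0 := by exact_mod_cast (hs k).ne'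
      -- Here `b_k = -(s k)²` and `a_k = s k / √q`, so this is the equation for `v k` divided by `s
      -- k`.
      have h2 : (s k : ℂ) * u k
          = -((s k)⁻¹ : ℝ) * v k + ((Real.sqrt q)⁻¹ : ℝ) * u (k + 1) + u (k - 1) := by
        have h3 := h k
        rw [jacobiExpr, coeffB_eq_neg_sq hq ht, coeffA_eq_mul hq ht k] at h3
        rw [h3]
        change _ = -(((s k)⁻¹ : ℝ) : ℂ) * ((((Real.sqrt q)⁻¹ * s k : ℝ) : ℂ) * u (k + 1)
          + ((-(s k) ^ 2 : ℝ) : ℂ) * u k + (s k : ℂ) * u (k - 1)) + _ + _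
        push_cast
        field_simp
        ring
      have h3 : (s k)⁻¹ ≤ C := (inv_anti₀ (hs 0) h1).trans hC1
      calc s k * ‖u k‖ = ‖(s k : ℂ) * u k‖ := by
            rw [norm_mul, Complex.norm_real, Real.norm_of_nonneg (hs k).le]
        _ ≤ ‖-((s k)⁻¹ : ℝ) * v k‖ + ‖(((Real.sqrt q)⁻¹ : ℝ) : ℂ) * u (k + 1)‖ + ‖u (k - 1)‖ := by
            rw [h2]
            exact norm_add₃_le
        _ = (s k)⁻¹ * ‖v k‖ + (Real.sqrt q)⁻¹ * ‖u (k + 1)‖ + 1 * ‖u (k - 1)‖ := by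
            rw [norm_mul, norm_mul, norm_neg, Complex.norm_real, Complex.norm_real,
              Real.norm_of_nonneg (inv_nonneg.2 (hs k).le),
              Real.norm_of_nonneg (inv_nonneg.2 (Real.sqrt_nonneg q)), one_mul]
        _ ≤ C * ‖v k‖ + C * ‖u (k + 1)‖ + C * ‖u (k - 1)‖ := by gcongr
        _ ≤ _ := by nlinarith [norm_nonneg (u k)]
  have hv := summable_norm_sq v
  have hu := summable_norm_sq u
  have hu1 := (Equiv.addRight (1 : ℤ)).summable_iff.2 hu
  have hu2 := (Equiv.subRight (1 : ℤ)).summable_iff.2 hu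
  refine Summable.of_nonneg_of_le (fun k => sq_nonneg _) (fun k => ?_)
    ((((hv.add hu1).add hu).add hu2).mul_left (4 * C ^ 2))
  simp only [Function.comp_apply, Equiv.coe_addRight, Equiv.subRight_apply]
  have h1 : (s k * ‖u k‖) ^ 2 ≤ (C * (‖v k‖ + ‖u (k + 1)‖ + ‖u k‖ + ‖u (k - 1)‖)) ^ 2 :=
    pow_le_pow_left₀ (mul_nonneg (hs k).le (norm_nonneg _)) (key k) 2
  refine h1.trans ?_
  rw [mul_pow, mul_comm (4 : ℝ), mul_assoc]
  gcongr
  -- The factor 4 comes from `(a + b + c + d)² ≤ 4(a² + b² + c² + d²)`.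
  nlinarith [sq_nonneg (‖v k‖ - ‖u (k + 1)‖), sq_nonneg (‖v k‖ - ‖u k‖),
    sq_nonneg (‖v k‖ - ‖u (k - 1)‖), sq_nonneg (‖u (k + 1)‖ - ‖u k‖),
    sq_nonneg (‖u (k + 1)‖ - ‖u (k - 1)‖), sq_nonneg (‖u k‖ - ‖u (k - 1)‖)]

theorem summable_of_norm_le_mul {f : ℤ → ℂ} {x y : ℤ → ℝ} (hx : Summable fun k => x k ^ 2)
    (hy : Summable fun k => y k ^ 2) (h : ∀ k, ‖f k‖ ≤ x k * y k) : Summable f := by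
  refine Summable.of_norm_bounded ((hx.add hy).mul_left (1 / 2)) fun k => (h k).trans ?_
  nlinarith [sq_nonneg (x k - y k)]

/-- With `(a_{k-1} u_k)` square summable on the maximal domain, all three sums in the summation by
parts converge absolutely, so nothing is left over at infinity. -/
theorem isSelfAdjoint_adjoint_opJ (hq : 0 < q) (hq1 : q ≤ 1) (ht : 0 < t) :
    IsSelfAdjoint (opJ q t).adjoint := by
  refine isSelfAdjoint_adjoint (dense_opJ_domain q t) (opJ_le_adjoint q t) ?_
  intro a b u v hab huv
  rw [mem_graph_adjoint_opJ] at hab huv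
  rw [inner_eq_tsum, inner_eq_tsum]
  simp only [hab, huv]
  have ha := summable_norm_sq a
  have hu := summable_norm_sq u
  have hsa := summable_coeffA_mul_sq hq hq1 ht hab
  have hsu := summable_coeffA_mul_sq hq hq1 ht huv
  have hsa' := (Equiv.addRight (1 : ℤ)).summable_iff.2 hsa
  have hsu' := (Equiv.addRight (1 : ℤ)).summable_iff.2 hsu
  simp only [Function.comp_def, Equiv.coe_addRight, add_sub_cancel_right] at hsa' hsu'
  have hA : ∀ k, ‖(coeffA q t k : ℂ)‖ = coeffA q t k := fun k => by
    rw [Complex.norm_real, Real.norm_of_nonneg (coeffA_pos hq ht k).le]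
  refine tsum_jacobiExpr_comm ?_ ?_ ?_
  · refine summable_of_norm_le_mul hsu' ha fun k => ?_
    rw [norm_mul, norm_mul, norm_star, hA, mul_assoc]
  · refine summable_of_norm_le_mul hsa' hu fun k => ?_
    rw [norm_mul, norm_mul, norm_star, hA, mul_assoc, mul_comm ‖u k‖]
  · refine summable_of_norm_le_mul hsu hsa fun k => ?_
    rw [norm_mul, norm_mul, norm_star, coeffB_eq_neg_sq hq ht, Complex.norm_real, norm_neg,
      norm_pow, Real.norm_of_nonneg (coeffA_pos hq ht _).le]
    exact le_of_eq (by ring)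

end Jacobi

/-! ## Decomposition of the half line along the multiplicative lattice -/

section Cells

variable {q : ℝ} {w : ℝ → ℝ}

/-- The index `k` with `q^(k+1) < x ≤ q^k`. -/
def cell (q x : ℝ) : ℤ := ⌊Real.log x / Real.log q⌋

theorem measurable_cell (q : ℝ) : Measurable (cell q) :=
  (Real.measurable_log.div_const _).floor

theorem cell_eq_iff (hq : 0 < q) (hq1 : q < 1) {x : ℝ} (hx : 0 < x) {k : ℤ} :
    cell q x = k ↔ x ∈ Ioc (q ^ (k + 1)) (q ^ k) := by
  have hlog : Real.log q < 0 := Real.log_neg hq hq1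
  rw [cell, Int.floor_eq_iff, le_div_iff_of_neg hlog, div_lt_iff_of_neg hlog, mem_Ioc, and_comm]
  have h1 : ((k : ℝ) + 1) * Real.log q = Real.log (q ^ (k + 1)) := by
    rw [Real.log_zpow]
    push_cast
    rfl
  rw [h1, ← Real.log_zpow, Real.log_lt_log_iff (by positivity) hx,
    Real.log_le_log_iff hx (by positivity)]

theorem mul_zpow_mem_Ioc (hq : 0 < q) {t : ℝ} {k : ℤ} :
    t * q ^ k ∈ Ioc (q ^ (k + 1)) (q ^ k) ↔ t ∈ Ioc q 1 := by
  have hk : 0 < q ^ k := by positivity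
  rw [mem_Ioc, mem_Ioc, zpow_add_one₀ hq.ne', mul_comm (q ^ k) q, mul_lt_mul_iff_left₀ hk,
    mul_le_iff_le_one_left hk]

theorem cell_mul_zpow (hq : 0 < q) (hq1 : q < 1) {t : ℝ} (ht : t ∈ Ioc q 1) (k : ℤ) :
    cell q (t * q ^ k) = k :=
  (cell_eq_iff hq hq1 (mul_pos (hq.trans ht.1) (by positivity))).2 ((mul_zpow_mem_Ioc hq).2 ht)

theorem Ioi_eq_iUnion_Ioc_zpow (hq : 0 < q) (hq1 : q < 1) :
    Ioi (0 : ℝ) = ⋃ k : ℤ, Ioc (q ^ (k + 1)) (q ^ k) := by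
  ext x
  rw [mem_iUnion]
  refine ⟨fun hx => ⟨cell q x, (cell_eq_iff hq hq1 hx).1 rfl⟩, fun ⟨k, hk⟩ => ?_⟩
  exact lt_trans (by positivity) hk.1

theorem pairwise_disjoint_Ioc_zpow (hq : 0 < q) (hq1 : q < 1) :
    Pairwise (Function.onFun Disjoint fun k : ℤ => Ioc (q ^ (k + 1)) (q ^ k)) := by
  intro i j hij
  refine Set.disjoint_left.2 fun x hi hj => hij ?_
  have hx : 0 < x := lt_trans (by positivity) hi.1
  rw [← (cell_eq_iff hq hq1 hx).2 hi, ← (cell_eq_iff hq hq1 hx).2 hj]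

theorem setLIntegral_Ioc_zpow (hq : 0 < q) {G : ℝ → ENNReal} (hG : Measurable G) (k : ℤ) :
    ∫⁻ x in Ioc (q ^ (k + 1)) (q ^ k), G x
      = ∫⁻ t in Ioc q 1, ENNReal.ofReal (q ^ k) * G (t * q ^ k) := by
  have hk : 0 < q ^ k := by positivity
  have hpre : (fun t : ℝ => t * q ^ k) ⁻¹' Ioc (q ^ (k + 1)) (q ^ k) = Ioc q 1 := by
    ext t
    exact mul_zpow_mem_Ioc hq
  rw [lintegral_const_mul _ (by fun_prop)]
  conv_lhs => rw [← Real.smul_map_volume_mul_right hk.ne']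
  rw [Measure.restrict_smul, lintegral_smul_measure, abs_of_pos hk,
    setLIntegral_map measurableSet_Ioc hG (by fun_prop), hpre, smul_eq_mul]

theorem measurableSet_omega (hw : Measurable w) : MeasurableSet (omega q w) :=
  measurableSet_Ioc.inter (measurableSet_lt measurable_const hw)

theorem IsWeight.pos_mul_zpow_iff (h : IsWeight q w) {t : ℝ} (ht : 0 < t) (k : ℤ) :
    0 < w (t * q ^ k) ↔ 0 < w t := by
  have hq := h.q_pos
  have step : ∀ j : ℤ, 0 < w (t * q ^ (j + 1)) ↔ 0 < w (t * q ^ j) := by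
    intro j
    have hj : 0 < t * q ^ j := by positivity
    rw [zpow_add_one₀ hq.ne', ← mul_assoc, h.func_eq _ hj, mul_pos_iff_of_pos_left hj]
  induction k using Int.induction_on with
  | zero => simp
  | succ i ih => exact (step _).trans ih
  | pred i ih =>
    have h1 := step (-(i : ℤ) - 1)
    rw [sub_add_cancel] at h1
    exact h1.symm.trans ih

theorem ofReal_mul_weight_pos (h : IsWeight q w) {t : ℝ} (ht : t ∈ omega q w) (k : ℤ) :
    ENNReal.ofReal (q ^ k * w (t * q ^ k)) ≠ 0 := by
  have hq := h.q_pos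
  have h1 := (h.pos_mul_zpow_iff (hq.trans ht.1.1) k).2 ht.2
  rw [Ne, ENNReal.ofReal_eq_zero, not_le]
  positivity

/-- Each cell is `(q,1]` scaled by `q^k`, with Jacobian `q^k`. The functional equation makes `w`
positive on all of `{tq^k}` or on none of it, so only `t` in `Ω` contributes. -/
theorem IsWeight.lintegral_eq (h : IsWeight q w) {F : ℝ → ENNReal} (hF : Measurable F) :
    ∫⁻ x, F x ∂(weightMeasure w) = ∫⁻ t in omega q w,
      ∑' k : ℤ, F (t * q ^ k) * ENNReal.ofReal (q ^ k * w (t * q ^ k)) := by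
  have hq := h.q_pos
  have hw : Measurable fun x => ENNReal.ofReal (w x) := h.measurable.ennreal_ofReal
  have hG : Measurable fun x => ENNReal.ofReal (w x) * F x := hw.mul hF
  have hm : ∀ k : ℤ, Measurable fun t : ℝ =>
      ENNReal.ofReal (q ^ k) * (ENNReal.ofReal (w (t * q ^ k)) * F (t * q ^ k)) := fun k =>
    (hG.comp (measurable_mul_const (q ^ k))).const_mul _
  rw [weightMeasure, lintegral_withDensity_eq_lintegral_mul _ hw hF]
  simp only [Pi.mul_apply]
  rw [Ioi_eq_iUnion_Ioc_zpow hq h.q_lt_one, lintegral_iUnion (fun k => measurableSet_Ioc)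
    (pairwise_disjoint_Ioc_zpow hq h.q_lt_one)]
  simp only [setLIntegral_Ioc_zpow hq hG]
  rw [← lintegral_tsum fun k => (hm k).aemeasurable,
    ← lintegral_indicator measurableSet_Ioc, ← lintegral_indicator (measurableSet_omega h.measurable)]
  refine lintegral_congr fun t => ?_
  by_cases ht : t ∈ Ioc q 1
  · have ht0 : 0 < t := hq.trans ht.1
    rw [indicator_of_mem ht]
    by_cases hwt : 0 < w t
    · rw [indicator_of_mem (show t ∈ omega q w from ⟨ht, hwt⟩)]
      refine tsum_congr fun k => ?_
      rw [ENNReal.ofReal_mul (by positivity)]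
      ring
    · rw [indicator_of_notMem (show t ∉ omega q w from fun h => hwt h.2), ENNReal.tsum_eq_zero]
      intro k
      rw [ENNReal.ofReal_eq_zero.2 (not_lt.1 (mt (h.pos_mul_zpow_iff ht0 k).1 hwt)), zero_mul,
        mul_zero]
  · rw [indicator_of_notMem ht, indicator_of_notMem (show t ∉ omega q w from fun h => ht h.1)]

theorem measurable_lattice_tsum (hw : Measurable w) {F : ℝ → ENNReal} (hF : Measurable F) :
    Measurable fun t => ∑' k : ℤ, F (t * q ^ k) * ENNReal.ofReal (q ^ k * w (t * q ^ k)) := by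
  refine Measurable.tsum fun k => ?_
  have h1 := measurable_mul_const (q ^ k)
  exact (hF.comp h1).mul ((hw.comp h1).const_mul _).ennreal_ofReal

/-- Null sets correspond because every lattice weight `q^k w(tq^k)` is nonzero for `t` in `Ω`. -/
theorem IsWeight.ae_iff (h : IsWeight q w) {p : ℝ → Prop} (hp : MeasurableSet {x | p x}) :
    (∀ᵐ x ∂(weightMeasure w), p x) ↔ ∀ᵐ t ∂(omegaMeasure q w), ∀ k : ℤ, p (t * q ^ k) := by
  have hF : Measurable ({x | p x}ᶜ.indicator fun _ : ℝ => (1 : ENNReal)) :=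
    measurable_const.indicator hp.compl
  have h1 : (∀ᵐ x ∂(weightMeasure w), p x) ↔
      ∫⁻ x, {x | p x}ᶜ.indicator (fun _ => (1 : ENNReal)) x ∂(weightMeasure w) = 0 := by
    rw [lintegral_indicator hp.compl, setLIntegral_one]
    rfl
  rw [h1, h.lintegral_eq hF, lintegral_eq_zero_iff (measurable_lattice_tsum h.measurable hF)]
  have hmem : ∀ᵐ t ∂(omegaMeasure q w), t ∈ omega q w :=
    ae_restrict_mem (measurableSet_omega h.measurable)
  refine eventually_congr ?_
  filter_upwards [hmem] with t ht
  rw [Pi.zero_apply, ENNReal.tsum_eq_zero]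
  refine forall_congr' fun k => ?_
  rw [mul_eq_zero, or_iff_left (ofReal_mul_weight_pos h ht k)]
  by_cases hx : p (t * q ^ k) <;> simp [hx]

theorem IsWeight.ae_lattice (h : IsWeight q w) {p : ℝ → Prop}
    (hp : ∀ᵐ x ∂(weightMeasure w), p x) :
    ∀ᵐ t ∂(omegaMeasure q w), ∀ k : ℤ, p (t * q ^ k) := by
  obtain ⟨s, hs, hsm, hs0⟩ := exists_measurable_superset_of_null (MeasureTheory.ae_iff.1 hp)
  have h1 : ∀ᵐ x ∂(weightMeasure w), x ∈ sᶜ := by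
    rw [MeasureTheory.ae_iff]
    simpa using hs0
  filter_upwards [(h.ae_iff (p := fun x => x ∈ sᶜ) hsm.compl).1 h1] with t ht k
  by_contra hcon
  exact ht k (hs hcon)

end Cells

/-! ## The unitary operator `I` -/

section Unitary

variable {q : ℝ} {w : ℝ → ℝ}

/-- The sequence `k ↦ f(tq^k) q^{k/2} √w(tq^k)`. -/
def latticeSeq (q : ℝ) (w : ℝ → ℝ) (f : ℝ → ℂ) (t : ℝ) (k : ℤ) : ℂ :=
  f (t * q ^ k) * ((q ^ ((k : ℝ) / 2) : ℝ) : ℂ) * (Real.sqrt (w (t * q ^ k)) : ℂ)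

theorem rpow_half_sq (hq : 0 < q) (k : ℤ) : (q ^ ((k : ℝ) / 2)) ^ 2 = q ^ k := by
  rw [← Real.rpow_natCast, ← Real.rpow_mul hq.le, Nat.cast_ofNat, div_mul_cancel₀ _ two_ne_zero,
    Real.rpow_intCast]

/-- The factor `q^{k/2} √w` is the square root of Jacobian times density; summed over `k` and
integrated, this is the isometry property of `I`. -/
theorem IsWeight.enorm_latticeSeq_sq (h : IsWeight q w) (f : ℝ → ℂ) {t : ℝ} (ht : 0 < t) (k : ℤ) :
    ‖latticeSeq q w f t k‖ₑ ^ 2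
      = ‖f (t * q ^ k)‖ₑ ^ 2 * ENNReal.ofReal (q ^ k * w (t * q ^ k)) := by
  have hq := h.q_pos
  have hw : 0 ≤ w (t * q ^ k) := h.nonneg _ (by positivity)
  have h1 : (q ^ k * w (t * q ^ k)) = ‖(((q ^ ((k : ℝ) / 2) : ℝ) : ℂ)
      * (Real.sqrt (w (t * q ^ k)) : ℂ))‖ ^ 2 := by
    rw [norm_mul, Complex.norm_real, Complex.norm_real, Real.norm_of_nonneg (by positivity),
      Real.norm_of_nonneg (Real.sqrt_nonneg _), mul_pow, Real.sq_sqrt hw, rpow_half_sq hq]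
  rw [h1, ENNReal.ofReal_pow (norm_nonneg _), ofReal_norm, latticeSeq, mul_assoc, enorm_mul,
    mul_pow]

theorem eLpNorm_two_sq {α E : Type*} [MeasurableSpace α] [NormedAddCommGroup E] (μ : Measure α)
    (f : α → E) : eLpNorm f 2 μ ^ 2 = ∫⁻ x, ‖f x‖ₑ ^ 2 ∂μ := by
  have := eLpNorm_nnreal_pow_eq_lintegral (μ := μ) (f := f) (p := 2) two_ne_zero
  simpa using this

theorem enorm_sq_eq_tsum (v : Ell2) : ‖v‖ₑ ^ 2 = ∑' k, ‖v k‖ₑ ^ 2 := by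
  have h1 : ‖v‖ ^ 2 = ∑' k, ‖v k‖ ^ 2 := by
    have := lp.norm_rpow_eq_tsum (p := 2) (by simp) v
    simpa using this
  rw [← ofReal_norm, ← ENNReal.ofReal_pow (norm_nonneg _), h1,
    ENNReal.ofReal_tsum_of_nonneg (fun k => sq_nonneg _) (summable_norm_sq v)]
  refine tsum_congr fun k => ?_
  rw [ENNReal.ofReal_pow (norm_nonneg _), ofReal_norm]

theorem memℓp_two_of_tsum_ne_top {v : ℤ → ℂ} (hv : ∑' k, ‖v k‖ₑ ^ 2 ≠ ⊤) : Memℓp v 2 := by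
  refine memℓp_gen ?_
  have := ENNReal.summable_toReal hv
  simpa using this

/-- The finite coordinate sums converge to `G x` in `ℓ²` for almost every `x`. -/
theorem aestronglyMeasurable_of_coord {α : Type*} [MeasurableSpace α] {μ : Measure α}
    {G : α → Ell2} {g : α → ℤ → ℂ} (hg : ∀ k, AEStronglyMeasurable (fun x => g x k) μ)
    (h : ∀ᵐ x ∂μ, ∀ k, G x k = g x k) : AEStronglyMeasurable G μ := by
  refine aestronglyMeasurable_of_tendsto_ae atTop
    (f := fun (s : Finset ℤ) x => ∑ k ∈ s, g x k • lp.single 2 k (1 : ℂ)) (fun s => ?_) ?_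
  · exact Finset.aestronglyMeasurable_fun_sum _ fun k _ => (hg k).smul_const _
  · filter_upwards [h] with x hx
    refine (lp.hasSum_single (by simp) (G x)).congr fun s => ?_
    refine Finset.sum_congr rfl fun k _ => ?_
    beta_reduce
    rw [← lp.single_smul, smul_eq_mul, mul_one, ← hx]

open Classical in
/-- The `ℓ²(ℤ)`-valued function `t ↦ ∑_k f(tq^k) q^{k/2} √w(tq^k) e_k`. -/
def latticeFun (q : ℝ) (w : ℝ → ℝ) (f : ℝ → ℂ) (t : ℝ) : Ell2 :=
  if h : Memℓp (latticeSeq q w f t) 2 then ⟨latticeSeq q w f t, h⟩ else 0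

theorem IsWeight.ae_mem_omega (h : IsWeight q w) : ∀ᵐ t ∂(omegaMeasure q w), t ∈ omega q w :=
  ae_restrict_mem (measurableSet_omega h.measurable)

theorem IsWeight.lintegral_enorm_sq_eq (h : IsWeight q w) {f : ℝ → ℂ} (hf : Measurable f) :
    ∫⁻ x, ‖f x‖ₑ ^ 2 ∂(weightMeasure w)
      = ∫⁻ t, ∑' k, ‖latticeSeq q w f t k‖ₑ ^ 2 ∂(omegaMeasure q w) := by
  rw [h.lintegral_eq (hf.enorm.pow_const 2)]
  refine lintegral_congr_ae ?_
  filter_upwards [h.ae_mem_omega] with t ht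
  exact tsum_congr fun k => (h.enorm_latticeSeq_sq f (h.q_pos.trans ht.1.1) k).symm

theorem measurable_latticeSeq (hw : Measurable w) {f : ℝ → ℂ} (hf : Measurable f) (k : ℤ) :
    Measurable fun t => latticeSeq q w f t k := by
  have h1 := measurable_mul_const (q ^ k)
  have h2 := (hw.comp h1).sqrt
  exact ((hf.comp h1).mul_const _).mul (Complex.measurable_ofReal.comp h2)

theorem IsWeight.ae_memℓp_latticeSeq (h : IsWeight q w) {f : ℝ → ℂ} (hf : Measurable f)
    (hf2 : MemLp f 2 (weightMeasure w)) :
    ∀ᵐ t ∂(omegaMeasure q w), Memℓp (latticeSeq q w f t) 2 := by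
  have hm : Measurable fun t => ∑' k, ‖latticeSeq q w f t k‖ₑ ^ 2 :=
    Measurable.tsum fun k => (measurable_latticeSeq h.measurable hf k).enorm.pow_const 2
  have h1 : ∫⁻ t, ∑' k, ‖latticeSeq q w f t k‖ₑ ^ 2 ∂(omegaMeasure q w) ≠ ⊤ := by
    rw [← h.lintegral_enorm_sq_eq hf, ← eLpNorm_two_sq]
    exact ENNReal.pow_ne_top hf2.2.ne
  filter_upwards [ae_lt_top hm h1] with t ht
  exact memℓp_two_of_tsum_ne_top ht.ne

theorem IsWeight.latticeFun_apply (h : IsWeight q w) {f : ℝ → ℂ} (hf : Measurable f)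
    (hf2 : MemLp f 2 (weightMeasure w)) :
    ∀ᵐ t ∂(omegaMeasure q w), ∀ k, latticeFun q w f t k = latticeSeq q w f t k := by
  filter_upwards [h.ae_memℓp_latticeSeq hf hf2] with t ht k
  rw [latticeFun, dif_pos ht]

theorem lintegral_enorm_sq_coord {μ : Measure ℝ} {G : ℝ → Ell2} {g : ℝ → ℤ → ℂ}
    (hG : ∀ᵐ t ∂μ, ∀ k, G t k = g t k) :
    ∫⁻ t, ‖G t‖ₑ ^ 2 ∂μ = ∫⁻ t, ∑' k, ‖g t k‖ₑ ^ 2 ∂μ := by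
  refine lintegral_congr_ae ?_
  filter_upwards [hG] with t ht
  simp only [enorm_sq_eq_tsum, ht]

theorem IsWeight.eLpNorm_latticeFun (h : IsWeight q w) {f : ℝ → ℂ} (hf : Measurable f)
    (hf2 : MemLp f 2 (weightMeasure w)) :
    eLpNorm (latticeFun q w f) 2 (omegaMeasure q w) = eLpNorm f 2 (weightMeasure w) := by
  have h1 : eLpNorm (latticeFun q w f) 2 (omegaMeasure q w) ^ 2
      = eLpNorm f 2 (weightMeasure w) ^ 2 := by
    rw [eLpNorm_two_sq, eLpNorm_two_sq, h.lintegral_enorm_sq_eq hf,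
      lintegral_enorm_sq_coord (h.latticeFun_apply hf hf2)]
  exact (ENNReal.pow_right_strictMono two_ne_zero).injective h1

theorem IsWeight.memLp_latticeFun (h : IsWeight q w) {f : ℝ → ℂ} (hf : Measurable f)
    (hf2 : MemLp f 2 (weightMeasure w)) :
    MemLp (latticeFun q w f) 2 (omegaMeasure q w) :=
  ⟨aestronglyMeasurable_of_coord
    (fun k => (measurable_latticeSeq h.measurable hf k).aestronglyMeasurable)
    (h.latticeFun_apply hf hf2), by
    rw [h.eLpNorm_latticeFun hf hf2]
    exact hf2.2⟩

theorem ext_coord {μ : Measure ℝ} {u v : Lp Ell2 2 μ} (h : ∀ᵐ t ∂μ, ∀ k, u t k = v t k) :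
    u = v := by
  refine Lp.ext ?_
  filter_upwards [h] with t ht
  ext k
  exact ht k

/-- The isometry `I`, on classes. -/
def IsWeight.toDirect (h : IsWeight q w) (f : L2 w) : DirectL2 q w :=
  (h.memLp_latticeFun (Lp.stronglyMeasurable f).measurable (Lp.memLp f)).toLp _

theorem IsWeight.toDirect_apply (h : IsWeight q w) (f : L2 w) :
    ∀ᵐ t ∂(omegaMeasure q w), ∀ k, h.toDirect f t k = latticeSeq q w f t k := by
  have hf := (Lp.stronglyMeasurable f).measurable
  filter_upwards [h.latticeFun_apply hf (Lp.memLp f),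
    (h.memLp_latticeFun hf (Lp.memLp f)).coeFn_toLp] with t h1 h2 k
  rw [IsWeight.toDirect, h2, h1]

/-- The isometry `I : L²(μ) → ∫^⊕ ℓ²(ℤ) dt`. -/
def IsWeight.isometryI (h : IsWeight q w) : L2 w →ₗᵢ[ℂ] DirectL2 q w where
  toFun := h.toDirect
  map_add' f g := by
    refine ext_coord ?_
    filter_upwards [h.toDirect_apply f, h.toDirect_apply g, h.toDirect_apply (f + g),
      h.ae_lattice (Lp.coeFn_add f g), Lp.coeFn_add (h.toDirect f) (h.toDirect g)]
      with t h1 h2 h3 h4 h5 k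
    rw [h3, h5, Pi.add_apply, lp.coeFn_add, Pi.add_apply, h1, h2]
    simp only [latticeSeq, h4, Pi.add_apply]
    ring
  map_smul' c f := by
    refine ext_coord ?_
    filter_upwards [h.toDirect_apply f, h.toDirect_apply (c • f),
      h.ae_lattice (Lp.coeFn_smul c f), Lp.coeFn_smul c (h.toDirect f)] with t h1 h3 h4 h5 k
    rw [h3, RingHom.id_apply, h5, Pi.smul_apply, lp.coeFn_smul, Pi.smul_apply, h1]
    simp only [latticeSeq, h4, Pi.smul_apply, smul_eq_mul]
    ring
  norm_map' f := by
    change ‖h.toDirect f‖ = ‖f‖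
    rw [IsWeight.toDirect, Lp.norm_toLp, Lp.norm_def,
      h.eLpNorm_latticeFun (Lp.stronglyMeasurable f).measurable (Lp.memLp f)]

/-- The preimage of `u` is explicit: on the `k`-th cell divide the `k`-th coordinate of `u(xq^{-k})`
by `q^{k/2} √w(x)`. Zeros of `w` do not matter, as `w > 0` on the lattice of any `t` in `Ω`. -/
theorem IsWeight.surjective_isometryI (h : IsWeight q w) :
    Function.Surjective h.isometryI := by
  intro u
  have hq := h.q_pos
  let F : ℤ → ℝ → ℂ := fun k x => u (x * (q ^ k)⁻¹) k
    / (((q ^ ((k : ℝ) / 2) : ℝ) : ℂ) * (Real.sqrt (w x) : ℂ))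
  have hF : ∀ k, Measurable (F k) := by
    intro k
    have h1 : Measurable fun x : ℝ => u (x * (q ^ k)⁻¹) k :=
      ((lp.evalCLM ℂ (fun _ : ℤ => ℂ) 2 k).continuous.comp_stronglyMeasurable
        (Lp.stronglyMeasurable u)).measurable.comp (measurable_mul_const _)
    exact h1.div ((Complex.measurable_ofReal.comp h.measurable.sqrt).const_mul _)
  let f : ℝ → ℂ := fun x => F (cell q x) x
  have hf : Measurable f :=
    (measurable_from_prod_countable_right (f := fun p : ℤ × ℝ => F p.1 p.2) hF).comp
      ((measurable_cell q).prodMk measurable_id)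
  have hfu : ∀ t ∈ omega q w, ∀ k, latticeSeq q w f t k = u t k := by
    intro t ht k
    have ht0 : 0 < t := hq.trans ht.1.1
    have hwk := (h.pos_mul_zpow_iff ht0 k).2 ht.2
    have h1 : (Real.sqrt (w (t * q ^ k)) : ℂ) ≠ 0 := by
      exact_mod_cast (Real.sqrt_pos.2 hwk).ne'
    have h2 : ((q ^ ((k : ℝ) / 2) : ℝ) : ℂ) ≠ 0 := by
      exact_mod_cast (Real.rpow_pos_of_pos hq _).ne'
    have hk : q ^ k ≠ 0 := by positivity
    simp only [latticeSeq, f, F]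
    rw [cell_mul_zpow hq h.q_lt_one ht.1, mul_inv_cancel_right₀ hk, mul_assoc,
      div_mul_cancel₀ _ (mul_ne_zero h2 h1)]
  have hfu' : ∀ᵐ t ∂(omegaMeasure q w), ∀ k, u t k = latticeSeq q w f t k := by
    filter_upwards [h.ae_mem_omega] with t ht k
    exact (hfu t ht k).symm
  have hf2 : MemLp f 2 (weightMeasure w) := by
    refine ⟨hf.aestronglyMeasurable, ?_⟩
    have h1 : eLpNorm f 2 (weightMeasure w) ^ 2 = eLpNorm u 2 (omegaMeasure q w) ^ 2 := by
      rw [eLpNorm_two_sq, eLpNorm_two_sq, h.lintegral_enorm_sq_eq hf,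
        lintegral_enorm_sq_coord hfu']
    rw [(ENNReal.pow_right_strictMono two_ne_zero).injective h1]
    exact (Lp.memLp u).2
  refine ⟨hf2.toLp f, ext_coord ?_⟩
  filter_upwards [h.toDirect_apply (hf2.toLp f), hfu', h.ae_lattice hf2.coeFn_toLp] with t h1 h2 h3 k
  change h.toDirect (hf2.toLp f) t k = _
  rw [h1, h2, latticeSeq, h3, latticeSeq]

/-- The unitary operator `I : L²(μ) → ∫^⊕ ℓ²(ℤ) dt`. -/
def IsWeight.unitaryI (h : IsWeight q w) : L2 w ≃ₗᵢ[ℂ] DirectL2 q w :=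
  LinearIsometryEquiv.ofSurjective h.isometryI h.surjective_isometryI

theorem IsWeight.unitaryI_apply (h : IsWeight q w) (f : L2 w) :
    ∀ᵐ t ∂(omegaMeasure q w), ∀ k, h.unitaryI f t k = latticeSeq q w f t k :=
  h.toDirect_apply f

theorem IsWeight.extendsI_unitaryI (h : IsWeight q w) : ExtendsI h.unitaryI :=
  fun f _ => h.unitaryI_apply f

end Unitary

/-! ## Unitary conjugation and bounded operators as graphs -/

section Graphs

variable {H K : Type*} [NormedAddCommGroup H] [InnerProductSpace ℂ H]
  [NormedAddCommGroup K] [InnerProductSpace ℂ K]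

theorem mem_graph_unitaryConj {U : H ≃ₗᵢ[ℂ] K} {A : K →ₗ.[ℂ] K} {f g : H} :
    (f, g) ∈ (unitaryConj U A).graph ↔ (U f, U g) ∈ A.graph := by
  rw [LinearPMap.mem_graph_iff, LinearPMap.mem_graph_iff]
  constructor
  · rintro ⟨⟨y, hy⟩, h1, h2⟩
    simp only at h1 h2
    subst h1 h2
    exact ⟨⟨U y, hy⟩, rfl, (U.apply_symm_apply _).symm⟩
  · rintro ⟨⟨y, hy⟩, h1, h2⟩
    simp only at h1 h2
    subst h1
    exact ⟨⟨f, hy⟩, rfl, (congrArg U.symm h2).trans (U.symm_apply_apply g)⟩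

theorem mem_graph_ofBounded {B : H →L[ℂ] H} {u v : H} :
    (u, v) ∈ (ofBounded B).graph ↔ B u = v := by
  rw [LinearPMap.mem_graph_iff]
  constructor
  · rintro ⟨⟨y, hy⟩, h1, h2⟩
    simp only at h1 h2
    subst h1
    exact h2
  · rintro rfl
    exact ⟨⟨u, Submodule.mem_top⟩, rfl, rfl⟩

end Graphs

/-! ## The operator `L` under the unitary `I` -/

section OperatorL

variable {q : ℝ} {w : ℝ → ℝ}

/-- The functional equation gives `√w(xq) = √x √w(x)`, which converts the coefficients `1`, `-1/x`,
`1/x` into `a_k`, `b_k`, `a_{k-1}`. -/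
theorem IsWeight.latticeSeq_diffExpr (h : IsWeight q w) (f : ℝ → ℂ) {t : ℝ} (ht : 0 < t) (k : ℤ) :
    latticeSeq q w (diffExpr q f) t k = jacobiExpr q t (latticeSeq q w f t) k := by
  have hq := h.q_pos
  have hw : ∀ j : ℤ, Real.sqrt (w (t * q ^ (j + 1)))
      = Real.sqrt (t * q ^ j) * Real.sqrt (w (t * q ^ j)) := by
    intro j
    have hj : 0 < t * q ^ j := by positivity
    rw [zpow_add_one₀ hq.ne', ← mul_assoc, h.func_eq _ hj, Real.sqrt_mul hj.le]
  have hr : ∀ j : ℤ, q ^ (((j + 1 : ℤ) : ℝ) / 2) = Real.sqrt q * q ^ ((j : ℝ) / 2) := by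
    intro j
    push_cast
    rw [add_div, Real.rpow_add hq, Real.sqrt_eq_rpow, mul_comm]
  have hs : ∀ j : ℤ, Real.sqrt (t * q ^ (j + 1)) = Real.sqrt q * Real.sqrt (t * q ^ j) := by
    intro j
    rw [zpow_add_one₀ hq.ne', ← mul_assoc, mul_comm _ q, Real.sqrt_mul hq.le]
  have hsq : ∀ j : ℤ, t * q ^ j = Real.sqrt (t * q ^ j) ^ 2 := fun j =>
    (Real.sq_sqrt (by positivity)).symm
  have hq2 : q = Real.sqrt q ^ 2 := (Real.sq_sqrt hq.le).symm
  have hqs : Real.sqrt q ≠ 0 := (Real.sqrt_pos.2 hq).ne'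
  -- Starting from the lowest index, the weights at all three lattice points are multiples of
  -- `√w(tq^j)`.
  obtain ⟨j, rfl⟩ : ∃ j, k = j + 1 := ⟨k - 1, by ring⟩
  have hsj : Real.sqrt (t * q ^ j) ≠ 0 := (Real.sqrt_pos.2 (by positivity)).ne'
  have e1 : t * q ^ (j + 1) * q = t * q ^ (j + 1 + 1) := by
    rw [zpow_add_one₀ hq.ne' (j + 1), mul_assoc]
  have e2 : t * q ^ (j + 1) / q = t * q ^ j := by
    rw [zpow_add_one₀ hq.ne']
    field_simp
  simp only [latticeSeq, diffExpr, jacobiExpr, e1, e2, coeffA, coeffB, add_sub_cancel_right]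
  rw [hw (j + 1), hw j, hr (j + 1), hr j, hsq (j + 1), hs (j + 1), hs j]
  rw [Real.sqrt_sq (by positivity)]
  generalize f (t * q ^ (j + 1 + 1)) = f2
  generalize f (t * q ^ (j + 1)) = f1
  generalize f (t * q ^ j) = f0
  have hqs' : ((Real.sqrt q : ℝ) : ℂ) ≠ 0 := by exact_mod_cast hqs
  have hsj' : ((Real.sqrt (t * q ^ j) : ℝ) : ℂ) ≠ 0 := by exact_mod_cast hsj
  push_cast
  field_simp
  ring

theorem IsWeight.unitaryI_opL (h : IsWeight q w) (f : (opL h).domain) :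
    ∀ᵐ t ∂(omegaMeasure q w), ∀ k,
      h.unitaryI (opL h f) t k = jacobiExpr q t (h.unitaryI (f : L2 w) t) k := by
  have h1 := h.ae_lattice (MemLp.coeFn_toLp (h.memLp_diffExpr (Lp.memLp f.1) f.2))
  filter_upwards [h1, h.unitaryI_apply (opL h f), h.unitaryI_apply (f : L2 w), h.ae_mem_omega]
    with t h1 h2 h3 ht k
  have h4 : (h.unitaryI (f : L2 w) t : ℤ → ℂ) = latticeSeq q w (f : L2 w) t := funext h3
  rw [h2, h4, ← h.latticeSeq_diffExpr _ (h.q_pos.trans ht.1.1), latticeSeq, latticeSeq, ← h1]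
  rfl

/-- The maximal operator `∫^⊕ J_t^* dt`. -/
abbrev maxOp (q : ℝ) (w : ℝ → ℝ) : DirectL2 q w →ₗ.[ℂ] DirectL2 q w :=
  directIntegral (omegaMeasure q w) fun t => (opJ q t).adjoint

theorem mem_graph_maxOp {u v : DirectL2 q w} :
    (u, v) ∈ (maxOp q w).graph ↔
      ∀ᵐ t ∂(omegaMeasure q w), ∀ k, v t k = jacobiExpr q t (u t) k := by
  rw [mem_graph_directIntegral]
  simp only [mem_graph_adjoint_opJ]

theorem IsWeight.inner_maxOp (h : IsWeight q w) {a b u v : DirectL2 q w}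
    (hab : (a, b) ∈ (maxOp q w).graph) (huv : (u, v) ∈ (maxOp q w).graph) :
    inner ℂ b u = inner ℂ a v := by
  rw [mem_graph_directIntegral] at hab huv
  rw [L2.inner_def, L2.inner_def]
  refine integral_congr_ae ?_
  filter_upwards [hab, huv, h.ae_mem_omega] with t h1 h2 ht
  exact (isSelfAdjoint_adjoint_opJ h.q_pos h.q_lt_one.le (h.q_pos.trans ht.1.1)).inner_graph h1 h2

theorem IsWeight.opL_le (h : IsWeight q w) : opL h ≤ unitaryConj h.unitaryI (maxOp q w) := by
  refine LinearPMap.le_of_le_graph ?_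
  rintro ⟨f, g⟩ hfg
  obtain ⟨y, hy, hy'⟩ := (LinearPMap.mem_graph_iff _).1 hfg
  simp only at hy hy'
  subst hy hy'
  rw [mem_graph_unitaryConj, mem_graph_maxOp]
  exact h.unitaryI_opL y

/-- The element `t ↦ ψ(t) e_k` of the direct integral. -/
def fiberSingle (k : ℤ) (ψ : Lp ℂ 2 (omegaMeasure q w)) : DirectL2 q w :=
  ((ContinuousLinearMap.id ℂ ℂ).smulRight (lp.single 2 k (1 : ℂ) : Ell2)).compLp ψ

theorem fiberSingle_apply (k : ℤ) (ψ : Lp ℂ 2 (omegaMeasure q w)) :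
    ∀ᵐ t ∂(omegaMeasure q w), fiberSingle k ψ t = lp.single 2 k (ψ t) := by
  filter_upwards [ContinuousLinearMap.coeFn_compLp
    ((ContinuousLinearMap.id ℂ ℂ).smulRight (lp.single 2 k (1 : ℂ) : Ell2)) ψ] with t ht
  rw [fiberSingle, ht]
  change ψ t • (lp.single 2 k (1 : ℂ) : Ell2) = _
  rw [← lp.single_smul, smul_eq_mul, mul_one]

/-- The `k`-th coordinate of an element of the direct integral. -/
def fiberCoord (k : ℤ) (u : DirectL2 q w) : Lp ℂ 2 (omegaMeasure q w) :=
  (lp.evalCLM ℂ (fun _ : ℤ => ℂ) 2 k).compLp u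

theorem fiberCoord_apply (k : ℤ) (u : DirectL2 q w) :
    ∀ᵐ t ∂(omegaMeasure q w), fiberCoord k u t = u t k :=
  ContinuousLinearMap.coeFn_compLp _ u

theorem inner_single (k : ℤ) (c : ℂ) (v : Ell2) :
    inner ℂ (lp.single 2 k c : Ell2) v = inner ℂ c (v k) := by
  rw [inner_eq_tsum, tsum_eq_single k]
  · rw [lp.single_apply_self]
    rfl
  · intro j hj
    rw [lp.single_apply_ne (E := fun _ : ℤ => ℂ) 2 k c hj, star_zero, mul_zero]

theorem inner_fiberSingle (k : ℤ) (ψ : Lp ℂ 2 (omegaMeasure q w)) (u : DirectL2 q w) :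
    inner ℂ (fiberSingle k ψ) u = inner ℂ ψ (fiberCoord k u) := by
  rw [L2.inner_def, L2.inner_def]
  refine integral_congr_ae ?_
  filter_upwards [fiberSingle_apply k ψ, fiberCoord_apply k u] with t h1 h2
  rw [h1, h2, inner_single]

/-- A field with only its `k`-th coordinate nonzero comes from a function living on the `k`-th cell,
whose closure is compact in `(0,∞)`. -/
theorem IsWeight.hasCptSupport_symm (h : IsWeight q w) {u : DirectL2 q w} {k : ℤ}
    (hu : ∀ᵐ t ∂(omegaMeasure q w), ∀ j ≠ k, u t j = 0) :
    h.unitaryI.symm u ∈ (opL h).domain := by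
  have hq := h.q_pos
  let f := h.unitaryI.symm u
  refine ⟨Icc (q ^ (k + 1)) (q ^ k), isCompact_Icc, fun x hx => lt_of_lt_of_le (by positivity) hx.1,
    ?_⟩
  have hm : MeasurableSet {x | x ∉ Icc (q ^ (k + 1)) (q ^ k) → f x = 0} := by
    have h1 : MeasurableSet {x | f x = 0} :=
      (Lp.stronglyMeasurable f).measurable (measurableSet_singleton 0)
    have h2 : {x | x ∉ Icc (q ^ (k + 1)) (q ^ k) → f x = 0}
        = Icc (q ^ (k + 1)) (q ^ k) ∪ {x | f x = 0} := by
      ext x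
      simp only [mem_ofPred_eq, mem_union]
      tauto
    rw [h2]
    exact measurableSet_Icc.union h1
  change ∀ᵐ x ∂(weightMeasure w), x ∉ Icc (q ^ (k + 1)) (q ^ k) → f x = 0
  rw [h.ae_iff hm]
  filter_upwards [hu, h.unitaryI_apply f, h.ae_mem_omega] with t h1 h2 ht j hj
  have hjk : j ≠ k := by
    rintro rfl
    exact hj (Ioc_subset_Icc_self ((mul_zpow_mem_Ioc hq).2 ht.1))
  have h3 := h2 j
  have h4 : h.unitaryI f = u := h.unitaryI.apply_symm_apply u
  rw [h4, h1 j hjk, latticeSeq] at h3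
  have hwj := (h.pos_mul_zpow_iff (hq.trans ht.1.1) j).2 ht.2
  have h5 : (Real.sqrt (w (t * q ^ j)) : ℂ) ≠ 0 := by exact_mod_cast (Real.sqrt_pos.2 hwj).ne'
  have h6 : ((q ^ ((j : ℝ) / 2) : ℝ) : ℂ) ≠ 0 := by exact_mod_cast (Real.rpow_pos_of_pos hq _).ne'
  exact (mul_eq_zero.1 ((mul_eq_zero.1 h3.symm).resolve_right h5)).resolve_right h6

theorem IsWeight.symm_fiberSingle_mem (h : IsWeight q w) (k : ℤ)
    (ψ : Lp ℂ 2 (omegaMeasure q w)) : h.unitaryI.symm (fiberSingle k ψ) ∈ (opL h).domain := by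
  refine h.hasCptSupport_symm (k := k) ?_
  filter_upwards [fiberSingle_apply k ψ] with t ht j hj
  rw [ht, lp.single_apply_ne (E := fun _ : ℤ => ℂ) 2 k _ hj]

/-- A vector orthogonal to all preimages of fields `ψ e_k` has every coordinate function zero. -/
theorem IsWeight.dense_opL_domain (h : IsWeight q w) : Dense ((opL h).domain : Set (L2 w)) := by
  rw [Submodule.dense_iff_topologicalClosure_eq_top, Submodule.topologicalClosure_eq_top_iff,
    Submodule.eq_bot_iff]
  intro g hg
  rw [Submodule.mem_orthogonal] at hg
  have h1 : ∀ k, fiberCoord k (h.unitaryI g) = 0 := by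
    intro k
    rw [← inner_self_eq_zero (𝕜 := ℂ), ← inner_fiberSingle]
    have h2 := hg _ (h.symm_fiberSingle_mem k (fiberCoord k (h.unitaryI g)))
    rw [← h.unitaryI.inner_map_map, h.unitaryI.apply_symm_apply] at h2
    exact h2
  have h2 : h.unitaryI g = 0 := by
    refine ext_coord ?_
    have h3 := ae_all_iff.2 fun k => fiberCoord_apply k (h.unitaryI g)
    filter_upwards [h3, Lp.coeFn_zero Ell2 2 (omegaMeasure q w),
      Lp.coeFn_zero ℂ 2 (omegaMeasure q w)] with t h3 h4 h5 k
    rw [← h3, h1, h4, h5]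
    rfl
  exact (map_eq_zero_iff _ h.unitaryI.injective).1 h2

/-- For fixed `k` the coefficients are bounded on `(q,1]`, by their absolute values at `t = q`. The
whole sequence need not be square integrable, only each coordinate. -/
theorem IsWeight.memLp_jacobiExpr (h : IsWeight q w) (u : DirectL2 q w) (k : ℤ) :
    MemLp (fun t => jacobiExpr q t (u t) k) 2 (omegaMeasure q w) := by
  have hq := h.q_pos
  have hcoord : ∀ j, MemLp (fun t => u t j) 2 (omegaMeasure q w) := fun j =>
    (memLp_congr_ae (fiberCoord_apply j u)).1 (Lp.memLp _)
  have hA : ∀ i j, MemLp (fun t => (coeffA q t i : ℂ) * u t j) 2 (omegaMeasure q w) := by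
    intro i j
    refine MemLp.of_le_mul (c := coeffA q q i) (hcoord j) ?_ ?_
    · refine AEStronglyMeasurable.mul ?_ (hcoord j).1
      have : Measurable fun t => coeffA q t i := by
        unfold coeffA
        fun_prop
      exact (Complex.measurable_ofReal.comp this).aestronglyMeasurable
    · filter_upwards [h.ae_mem_omega] with t ht
      have ht0 := hq.trans ht.1.1
      rw [norm_mul, Complex.norm_real, Real.norm_of_nonneg (coeffA_pos hq ht0 i).le]
      gcongr
      rw [coeffA, coeffA]
      have : q ≤ t := ht.1.1.le
      gcongr
  have hB : MemLp (fun t => (coeffB q t k : ℂ) * u t k) 2 (omegaMeasure q w) := by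
    refine MemLp.of_le_mul (c := 1 / (q * q ^ k)) (hcoord k) ?_ ?_
    · refine AEStronglyMeasurable.mul ?_ (hcoord k).1
      have : Measurable fun t => coeffB q t k := by
        unfold coeffB
        fun_prop
      exact (Complex.measurable_ofReal.comp this).aestronglyMeasurable
    · filter_upwards [h.ae_mem_omega] with t ht
      have ht0 := hq.trans ht.1.1
      have : q ≤ t := ht.1.1.le
      rw [norm_mul, Complex.norm_real, coeffB, norm_neg, Real.norm_of_nonneg (by positivity)]
      gcongr
  exact ((hA k (k + 1)).add hB).add (hA (k - 1) (k - 1))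

/-- Testing `L^*` on preimages of `ψ e_k` reads off the `k`-th coordinate of the fiber equation
almost everywhere. The converse is symmetry of the direct integral, which extends `L` after
conjugation. -/
theorem IsWeight.adjoint_opL (h : IsWeight q w) :
    (opL h).adjoint = unitaryConj h.unitaryI (maxOp q w) := by
  refine LinearPMap.eq_of_eq_graph (le_antisymm ?_ ?_)
  · rintro ⟨g, g'⟩ hg
    rw [mem_graph_adjoint_iff h.dense_opL_domain] at hg
    rw [mem_graph_unitaryConj, mem_graph_maxOp, ae_all_iff]
    intro k
    let u := h.unitaryI g
    let v := h.unitaryI g'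
    let D : Lp ℂ 2 (omegaMeasure q w) := (h.memLp_jacobiExpr u k).toLp _
    have hD : D = fiberCoord k v := by
      rw [← sub_eq_zero, ← inner_self_eq_zero (𝕜 := ℂ)]
      -- Both functions have the same pairing with every `ψ`; choosing their difference shows that
      -- it vanishes.
      let ψ := D - fiberCoord k v
      change inner ℂ ψ (D - fiberCoord k v) = 0
      let f : (opL h).domain := ⟨_, h.symm_fiberSingle_mem k ψ⟩
      have hf : h.unitaryI (f : L2 w) = fiberSingle k ψ := h.unitaryI.apply_symm_apply _
      have h1 := hg _ _ ((opL h).mem_graph f)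
      rw [← h.unitaryI.inner_map_map, ← h.unitaryI.inner_map_map (f : L2 w), hf,
        inner_fiberSingle] at h1
      have h2 : inner ℂ (h.unitaryI (opL h f)) u = inner ℂ ψ D := by
        rw [L2.inner_def, L2.inner_def]
        refine integral_congr_ae ?_
        filter_upwards [h.unitaryI_opL f, fiberSingle_apply k ψ,
          (h.memLp_jacobiExpr u k).coeFn_toLp] with t h3 h4 h5
        rw [hf, h4] at h3
        have h6 : (lp.single 2 k (ψ t), h.unitaryI (opL h f) t) ∈ (opJ q t).graph :=
          mem_opJ_graph.2 ⟨single_mem_opJ_domain (q := q) (t := t) k (ψ t), h3⟩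
        have h7 : inner ℂ (ψ t) (D t) = inner ℂ (ψ t) (jacobiExpr q t (u t) k) := by rw [h5]
        rw [h7, inner_opJ h6, tsum_eq_single k]
        · rw [lp.single_apply_self]
          rfl
        · intro j hj
          rw [lp.single_apply_ne (E := fun _ : ℤ => ℂ) 2 k _ hj, star_zero, mul_zero]
      rw [inner_sub_right, sub_eq_zero]
      exact h2.symm.trans h1
    filter_upwards [(h.memLp_jacobiExpr u k).coeFn_toLp, fiberCoord_apply k v] with t h1 h2
    rw [← h1, ← h2]
    change _ = D t
    rw [hD]
  · rintro ⟨g, g'⟩ hg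
    rw [mem_graph_unitaryConj] at hg
    rw [mem_graph_adjoint_iff h.dense_opL_domain]
    intro a b hab
    have h1 := LinearPMap.le_graph_of_le h.opL_le hab
    rw [mem_graph_unitaryConj] at h1
    rw [← h.unitaryI.inner_map_map, ← h.unitaryI.inner_map_map a]
    exact h.inner_maxOp h1 hg

theorem IsWeight.isSelfAdjoint_adjoint_opL (h : IsWeight q w) :
    IsSelfAdjoint (opL h).adjoint := by
  refine isSelfAdjoint_adjoint h.dense_opL_domain (h.adjoint_opL ▸ h.opL_le) ?_
  intro a b u v hab huv
  rw [h.adjoint_opL, mem_graph_unitaryConj] at hab huv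
  rw [← h.unitaryI.inner_map_map, ← h.unitaryI.inner_map_map a]
  exact h.inner_maxOp hab huv

end OperatorL

/-! ## The functional calculus of `L^*` -/

section FunctionalCalculus

variable {q : ℝ} {w : ℝ → ℝ}

/-- The functional calculus of `L^*` acts fiberwise. -/
theorem IsWeight.unitaryI_borelCalculus (h : IsWeight q w) (f : BddBorel) (u : L2 w) :
    ∀ᵐ t ∂(omegaMeasure q w), h.unitaryI (borelCalculus (opL h).adjoint f u) t
      = borelCalculus (opJ q t).adjoint f (h.unitaryI u t) := by
  obtain ⟨Φ, hΦ⟩ := h.isSelfAdjoint_adjoint_opL.exists_isBorelCalculus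
  have hJ : ∀ t, ∃ Ψ : BddBorel →⋆ₐ[ℂ] (Ell2 →L[ℂ] Ell2), t ∈ omega q w →
      IsBorelCalculus (opJ q t).adjoint Ψ := by
    intro t
    by_cases ht : t ∈ omega q w
    · obtain ⟨Ψ, hΨ⟩ := (isSelfAdjoint_adjoint_opJ h.q_pos h.q_lt_one.le
        (h.q_pos.trans ht.1.1)).exists_isBorelCalculus
      exact ⟨Ψ, fun _ => hΨ⟩
    -- Off `Ω` any homomorphism will do; the one for `t = 1` serves as a default.
    · obtain ⟨Ψ, -⟩ := (isSelfAdjoint_adjoint_opJ h.q_pos h.q_lt_one.le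
        one_pos).exists_isBorelCalculus
      exact ⟨Ψ, fun h => absurd h ht⟩
  choose Ψ hΨ using hJ
  suffices hs : ∀ f : BddBorel, ∀ u : L2 w, ∀ᵐ t ∂(omegaMeasure q w),
      h.unitaryI (Φ f u) t = Ψ t f (h.unitaryI u t) by
    rw [hΦ.borelCalculus_eq]
    filter_upwards [hs f u, h.ae_mem_omega] with t h1 ht
    rw [h1, (hΨ t ht).borelCalculus_eq]
  clear f u
  intro f
  induction f using BddBorel.induction with
  | const c =>
    intro u
    rw [AlgHomClass.commutes Φ, Algebra.algebraMap_eq_smul_one, smul_apply, one_apply_eq_self,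
      map_smul]
    filter_upwards [Lp.coeFn_smul c (h.unitaryI u)] with t h1
    rw [h1, AlgHomClass.commutes (Ψ t), Algebra.algebraMap_eq_smul_one, smul_apply,
      one_apply_eq_self, Pi.smul_apply]
  | resolvent z hz =>
    intro u
    obtain ⟨hv, h1⟩ := hΦ.resolvent_right z hz u
    -- The graph of `L^*` is fiberwise, so almost every fiber of the resolvent vector solves the
    -- resolvent equation of `J_t^*`. Measurability of `t ↦ f(J_t^*)` never has to be shown
    -- separately.
    have h2 := (opL h).adjoint.mem_graph ⟨_, hv⟩
    rw [eq_add_of_sub_eq h1] at h2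
    simp only at h2
    nth_rewrite 1 [h.adjoint_opL] at h2
    rw [mem_graph_unitaryConj, mem_graph_directIntegral, map_add, map_smul] at h2
    filter_upwards [h2, h.ae_mem_omega,
      Lp.coeFn_add (h.unitaryI u) (z • h.unitaryI (Φ (resolventFun z hz) u)),
      Lp.coeFn_smul z (h.unitaryI (Φ (resolventFun z hz) u))] with t h2 ht h3 h4
    rw [h3, Pi.add_apply, h4, Pi.smul_apply] at h2
    obtain ⟨y, hy, hy'⟩ := (LinearPMap.mem_graph_iff _).1 h2
    simp only at hy hy'
    have h5 := (hΨ t ht).resolvent_left z hz y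
    rw [hy', hy, add_sub_cancel_right] at h5
    exact h5.symm
  | add f g hf hg =>
    intro u
    rw [map_add, add_apply, map_add]
    filter_upwards [hf u, hg u, Lp.coeFn_add (h.unitaryI (Φ f u)) (h.unitaryI (Φ g u))]
      with t h1 h2 h3
    rw [h3, Pi.add_apply, h1, h2, map_add, add_apply]
  | mul f g hf hg =>
    intro u
    rw [_root_.map_mul, mul_apply_eq_comp]
    filter_upwards [hf (Φ g u), hg u] with t h1 h2
    rw [h1, h2, _root_.map_mul, mul_apply_eq_comp]
  | lim F f hF hC hlim =>
    intro u
    have h1 := (h.unitaryI.continuous.tendsto _).comp (hΦ.tendsto F f hC hlim u)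
    -- `L²` convergence gives almost everywhere convergence only along a subsequence. That is
    -- enough, as the fiber calculus already converges along the full sequence.
    obtain ⟨ns, hns, h2⟩ := (tendstoInMeasure_of_tendsto_Lp h1).exists_seq_tendsto_ae
    have h3 := ae_all_iff.2 fun n => hF n u
    filter_upwards [h2, h3, h.ae_mem_omega] with t h2 h3 ht
    refine tendsto_nhds_unique h2 ?_
    refine (((hΨ t ht).tendsto F f hC hlim (h.unitaryI u t)).comp hns.tendsto_atTop).congr
      fun n => ?_
    exact (h3 (ns n)).symm

end FunctionalCalculus

end StieltjesWigert

end

open StieltjesWigert in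
theorem proposition4p3 (q : ℝ) (w : ℝ → ℝ) (h : IsWeight q w) :
    Dense ((opL h).domain : Set (L2 w)) ∧
    (∀ t ∈ omega q w, Dense ((opJ q t).domain : Set Ell2) ∧ IsSelfAdjoint (opJ q t).adjoint ∧
      ∃! Φ : BddBorel →⋆ₐ[ℂ] (Ell2 →L[ℂ] Ell2), IsBorelCalculus (opJ q t).adjoint Φ) ∧
    ∃ I : L2 w ≃ₗᵢ[ℂ] DirectL2 q w, ExtendsI I ∧
      (opL h).adjoint =
        unitaryConj I (directIntegral (omegaMeasure q w) fun t => (opJ q t).adjoint) ∧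
      IsSelfAdjoint (opL h).adjoint ∧
      opL h ≤ (opL h).adjoint ∧
      (∀ A : L2 w →ₗ.[ℂ] L2 w, IsSelfAdjoint A → opL h ≤ A → A = (opL h).adjoint) ∧
      (∃! Φ : BddBorel →⋆ₐ[ℂ] (L2 w →L[ℂ] L2 w), IsBorelCalculus (opL h).adjoint Φ) ∧
      ∀ f : BddBorel,
        ofBounded (borelCalculus (opL h).adjoint f) =
          unitaryConj I (directIntegral (omegaMeasure q w) fun t =>
            ofBounded (borelCalculus (opJ q t).adjoint f)) := by
  have hL := h.isSelfAdjoint_adjoint_opL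
  refine ⟨h.dense_opL_domain, fun t ht => ?_, h.unitaryI, h.extendsI_unitaryI, h.adjoint_opL, hL,
    h.adjoint_opL ▸ h.opL_le, fun A hA hle => eq_adjoint_of_isSelfAdjoint hL h.dense_opL_domain hA hle,
    hL.existsUnique_isBorelCalculus, fun f => ?_⟩
  · have hJ := isSelfAdjoint_adjoint_opJ h.q_pos h.q_lt_one.le (h.q_pos.trans ht.1.1)
    exact ⟨dense_opJ_domain q t, hJ, hJ.existsUnique_isBorelCalculus⟩
  · refine LinearPMap.eq_of_eq_graph ?_
    ext ⟨u, v⟩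
    rw [mem_graph_ofBounded, mem_graph_unitaryConj, mem_graph_directIntegral]
    simp only [mem_graph_ofBounded]
    constructor
    -- This direction also shows that the direct integral on the right is defined everywhere.
    · rintro rfl
      filter_upwards [h.unitaryI_borelCalculus f u] with t ht
      exact ht.symm
    · intro huv
      refine h.unitaryI.injective (Lp.ext ?_)
      filter_upwards [h.unitaryI_borelCalculus f u, huv] with t h1 h2
      rw [h1, h2]
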